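/- Let $d_1, d_2 > 0$. Consider three agents with positions $p_1, p_2, p_3 \in \mathbb{R}^2$, and put $z_1 = p_1 - p_2$, $z_2 = p_2 - p_3$, $\hat z_k = z_k/\|z_k\|$ and $e_k = \|z_k\| - d_k$ for $k = 1, 2$. For $\theta \in (-\pi, \pi)$ and a gain $c > 0$, let $W(\alpha) = \begin{bmatrix}\cos\alpha & -\sin\alpha\\ \sin\alpha & \cos\alpha\end{bmatrix}$ and consider, on the set of configurations with $z_1 \neq 0$ and $z_2 \neq 0$, the system $$\dot p_1 = -\hat z_1 e_1, \qquad \dot p_2 = \hat z_1 e_1 - \hat z_2 e_2 + c\left(W(\tfrac{\theta}{2})\hat z_1 - W(\tfrac{\theta}{2})^T \hat z_2\right), \qquad \dot p_3 = \hat z_2 e_2 .$$ Let $$\mathcal{U} = \{(p_1, p_2, p_3) : W(\theta)\hat z_1 - \hat z_2 = 0,\ \|z_1\| = d_1,\ \|z_2\| = d_2\}.$$ Then for every $\theta \in (-\pi, \pi)$ there is a $c_0 > 0$ (depending on $\theta, d_1, d_2$) such that for every $c \in (0, c_0)$ the nonempty set $\mathcal{U}$ consists of equilibria and is locally exponentially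 stable. That is, there are $r, K, \kappa > 0$ such that from every initial configuration $p(0)$ with $\operatorname{dist}(p(0), \mathcal{U}) < r$ there is a solution for all $t \ge 0$, and every solution $p$ from $p(0)$ on an interval $[0, T)$ satisfies $$\operatorname{dist}(p(t), \mathcal{U}) \le K e^{-\kappa t} \operatorname{dist}(p(0), \mathcal{U}) \quad \text{for all } t \in [0, T).$$ -/

import Mathlib

open Set

noncomputable section

/-- The Euclidean plane. -/
abbrev Plane : Type := EuclideanSpace ℝ (Fin 2)

/-- A configuration `(p₁, p₂, p₃)` of the three agents, indexed by `0, 1, 2`. Its norm is the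
largest of the three Euclidean norms, which is equivalent to the Euclidean norm of `ℝ⁶`. -/
abbrev Config : Type := Fin 3 → Plane

/-- The rotation matrix `W(θ)`. -/
def rotMatrix (θ : ℝ) : Matrix (Fin 2) (Fin 2) ℝ :=
  !![Real.cos θ, -Real.sin θ; Real.sin θ, Real.cos θ]

/-- The product of a matrix and a vector of the plane. -/
def matVec (A : Matrix (Fin 2) (Fin 2) ℝ) (v : Plane) : Plane :=
  WithLp.toLp 2 (A.mulVec v.ofLp)

/-- The relative position `z₁ = p₁ - p₂`. -/
def relPos₁ (p : Config) : Plane := p 0 - p 1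

/-- The relative position `z₂ = p₂ - p₃`. -/
def relPos₂ (p : Config) : Plane := p 1 - p 2

/-- The unit vector `z / ‖z‖` (only used for `z ≠ 0`). -/
def unitVec (z : Plane) : Plane := ‖z‖⁻¹ • z

/-- The configurations at which the control law is defined: neither `z₁` nor `z₂` vanishes. -/
def collisionFree : Set Config := {p | relPos₁ p ≠ 0 ∧ relPos₂ p ≠ 0}

/-- The right-hand side of the closed-loop system
`p₁' = -e₁ ẑ₁`, `p₂' = e₁ ẑ₁ - e₂ ẑ₂ + c (W(θ/2) ẑ₁ - W(θ/2)ᵀ ẑ₂)`, `p₃' = e₂ ẑ₂`,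
where `e₁ = ‖z₁‖ - d₁` and `e₂ = ‖z₂‖ - d₂`. -/
def formationField (d₁ d₂ θ c : ℝ) (p : Config) : Config :=
  let u₁ : Plane := unitVec (relPos₁ p)
  let u₂ : Plane := unitVec (relPos₂ p)
  let e₁ : ℝ := ‖relPos₁ p‖ - d₁
  let e₂ : ℝ := ‖relPos₂ p‖ - d₂
  ![-(e₁ • u₁),
    e₁ • u₁ - e₂ • u₂
      + c • (matVec (rotMatrix (θ / 2)) u₁ - matVec (rotMatrix (θ / 2)).transpose u₂),
    e₂ • u₂]

/-- The target set: `W(θ) ẑ₁ - ẑ₂ = 0`, `‖z₁‖ = d₁`, `‖z₂‖ = d₂`. -/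
def targetSet (d₁ d₂ θ : ℝ) : Set Config :=
  {p | matVec (rotMatrix θ) (unitVec (relPos₁ p)) - unitVec (relPos₂ p) = 0 ∧
    ‖relPos₁ p‖ = d₁ ∧ ‖relPos₂ p‖ = d₂}

/-- `x` solves `x' = f(x)` on the time interval `J` and stays in the domain `D` of `f` there
(the derivative is one-sided at an end point of `J` that belongs to `J`). -/
def IsSolutionOn {E : Type*} [NormedAddCommGroup E] [NormedSpace ℝ E]
    (f : E → E) (D : Set E) (J : Set ℝ) (x : ℝ → E) : Prop :=
  ∀ t ∈ J, x t ∈ D ∧ HasDerivWithinAt x (f (x t)) J t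

/-- The nonempty set `A ⊆ D` of equilibria of `x' = f(x)`, `x ∈ D`, is locally exponentially
stable: there are a radius `r > 0` and constants `K, κ > 0` such that from every initial state
`x₀` at distance less than `r` from `A` there is a solution for all times `t ≥ 0`, and along
every solution from `x₀`, on whatever interval `[0, T)` it is given, the distance to `A` at time
`t` is at most `K * exp (-κ t)` times the initial distance. -/
def IsLocallyExponentiallyStable {E : Type*} [NormedAddCommGroup E] [NormedSpace ℝ E]
    (f : E → E) (D A : Set E) : Prop :=
  A.Nonempty ∧ A ⊆ D ∧ (∀ x ∈ A, f x = 0) ∧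
    ∃ r > (0 : ℝ), ∃ K > (0 : ℝ), ∃ κ > (0 : ℝ), ∀ x₀ : E, Metric.infDist x₀ A < r →
      (∃ x : ℝ → E, IsSolutionOn f D (Ici 0) x ∧ x 0 = x₀) ∧
      ∀ (T : ℝ) (x : ℝ → E), IsSolutionOn f D (Ico 0 T) x → x 0 = x₀ →
        ∀ t ∈ Ico 0 T,
          Metric.infDist (x t) A ≤ K * Real.exp (-κ * t) * Metric.infDist x₀ A

end

/-! The control law commutes with translations and rotations, so the distance errors e₁, e₂ and the
angle φ from W(θ)ẑ₁ to ẑ₂ obey a closed system, for which the target set is the single point e₁ = e₂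
= φ = 0. The angle enters only through σ = sin φ and κ = cos φ.

Linearised at c = 0, the block of e₁, e₂ has diagonal entries -2 and off-diagonal entries cos θ,
hence is negative definite, while the angle contributes an eigenvalue 0. With (l₁, l₂, 1) the left
null vector, ψ = σ + l₁e₁ + l₂e₂ is conserved to first order. For small c > 0 the zero eigenvalue
moves to -cμ to leading order, with μ = (1/d₁ + 1/d₂) cos(θ/2) / (2 - cos θ), positive since |θ| <
π. So e₁² + e₂² + ψ² decays under the linear flow (`quadratic_lyapunov`). The Lyapunov function adds
(1 - κ)², which is of fourth order at φ = 0 but excludes the antipodal angle, where σ also vanishes.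
The nonlinear terms are cubic and are absorbed near the target (`lyapunovDeriv_le_add_cubic`,
`exists_lyapunovDeriv_le`).

Although the target set is unbounded, the Lyapunov function is compared with the squared distance to
it by uniform constants (`exists_configLyapunov_le`, `infDist_targetSet_le`).
`hasDerivWithinAt_configLyapunov` transfers the decay to trajectories, and
`le_mul_exp_of_deriv_le_of_lt` keeps them in the region where it is valid. Global existence comes
from a bounded Lipschitz field that agrees with the closed loop there. -/

/-! ### Reduced error dynamics and their Lyapunov estimate -/

/-- The Lyapunov function in terms of the distance errors `e₁`, `e₂` and of the sine `σ` and cosine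
`κ` of the angle error. -/
def lyapunov (l₁ l₂ e₁ e₂ σ κ : ℝ) : ℝ :=
  e₁ ^ 2 + e₂ ^ 2 + (σ + l₁ * e₁ + l₂ * e₂) ^ 2 + (1 - κ) ^ 2

/-- The derivative of `e₁`, where `C` and `s` are the cosine and sine of `θ / 2`. -/
def errDeriv₁ (C s c e₁ e₂ σ κ : ℝ) : ℝ :=
  -2 * e₁ + e₂ * ((C ^ 2 - s ^ 2) * κ - 2 * s * C * σ) - c * (C * (1 - κ) + s * σ)

/-- The derivative of `e₂`. -/
def errDeriv₂ (C s c e₁ e₂ σ κ : ℝ) : ℝ :=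
  e₁ * ((C ^ 2 - s ^ 2) * κ - 2 * s * C * σ) - 2 * e₂ - c * (C * (1 - κ) + s * σ)

/-- The derivative of the angle error. -/
noncomputable def angleDeriv (d₁ d₂ C s c e₁ e₂ σ κ : ℝ) : ℝ :=
  -((e₁ * (2 * s * C * κ + (C ^ 2 - s ^ 2) * σ) + c * (C * σ - s * (1 - κ))) / (d₂ + e₂)) -
    (e₂ * (2 * s * C * κ + (C ^ 2 - s ^ 2) * σ) + c * (C * σ - s * (1 - κ))) / (d₁ + e₁)

/-- The derivative of the Lyapunov function. -/
noncomputable def lyapunovDeriv (d₁ d₂ C s c l₁ l₂ e₁ e₂ σ κ : ℝ) : ℝ :=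
  2 * (e₁ * errDeriv₁ C s c e₁ e₂ σ κ + e₂ * errDeriv₂ C s c e₁ e₂ σ κ +
    (σ + l₁ * e₁ + l₂ * e₂) * (κ * angleDeriv d₁ d₂ C s c e₁ e₂ σ κ +
      l₁ * errDeriv₁ C s c e₁ e₂ σ κ + l₂ * errDeriv₂ C s c e₁ e₂ σ κ) +
    (1 - κ) * (σ * angleDeriv d₁ d₂ C s c e₁ e₂ σ κ))

lemma abs_mul_le_mul {a b A B : ℝ} (ha : |a| ≤ A) (hb : |b| ≤ B) : |a * b| ≤ A * B := by
  rw [abs_mul]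
  exact mul_le_mul ha hb (abs_nonneg _) ((abs_nonneg _).trans ha)

/-- Linearises the angular velocities: as `A₀` and `e` are both of first order, freezing the
denominator at `d` costs only a second-order error. -/
lemma abs_div_sub_div_le {A A₀ d e m N : ℝ} (hd : 0 < d) (he : |e| ≤ d / 2) (heN : |e| ≤ N)
    (hA : |A - A₀| ≤ m * N ^ 2) (hA₀ : |A₀| ≤ m * N) :
    |A / (d + e) - A₀ / d| ≤ (2 * m / d + 2 * m / d ^ 2) * N ^ 2 := by
  have h1 : d / 2 ≤ d + e := by linarith [(abs_le.1 he).1]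
  have h0 : 0 < d + e := by linarith
  have hi : |(d + e)⁻¹| ≤ 2 / d := by
    rw [abs_of_pos (inv_pos.2 h0), inv_le_comm₀ h0 (by positivity)]
    simpa using h1
  have hid : |d⁻¹| ≤ d⁻¹ := by rw [abs_of_pos (inv_pos.2 hd)]
  have e1 : A / (d + e) - A₀ / d = (A - A₀) * (d + e)⁻¹ - A₀ * e * ((d + e)⁻¹ * d⁻¹) := by
    field_simp; ring
  rw [e1]
  refine (abs_sub _ _).trans ((add_le_add (abs_mul_le_mul hA hi)
    (abs_mul_le_mul (abs_mul_le_mul hA₀ heN) (abs_mul_le_mul hi hid))).trans_eq ?_)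
  field_simp

/-- The quadratic part of the Lyapunov derivative. -/
lemma quadratic_lyapunov {d₁ d₂ C s : ℝ} (hd₁ : 0 < d₁) (hd₂ : 0 < d₂) (hC : 0 < C)
    (hCs : C ^ 2 + s ^ 2 = 1) :
    ∃ l₁ l₂ : ℝ, ∃ c₀ > (0 : ℝ), ∀ c : ℝ, 0 < c → c < c₀ → ∃ m > (0 : ℝ), ∀ e₁ e₂ σ : ℝ,
      e₁ * (-2 * e₁ + e₂ * (C ^ 2 - s ^ 2) - c * (s * σ)) +
        e₂ * (e₁ * (C ^ 2 - s ^ 2) - 2 * e₂ - c * (s * σ)) +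
        (σ + l₁ * e₁ + l₂ * e₂) *
          (-((e₁ * (2 * s * C) + c * (C * σ)) / d₂) - (e₂ * (2 * s * C) + c * (C * σ)) / d₁ +
            l₁ * (-2 * e₁ + e₂ * (C ^ 2 - s ^ 2) - c * (s * σ)) +
            l₂ * (e₁ * (C ^ 2 - s ^ 2) - 2 * e₂ - c * (s * σ))) ≤
      -m * (e₁ ^ 2 + e₂ ^ 2 + (σ + l₁ * e₁ + l₂ * e₂) ^ 2) := by
  have hs1 : |s| ≤ 1 := abs_le_of_sq_le_sq (by nlinarith) (by norm_num)
  set g := C ^ 2 - s ^ 2 with hg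
  have hg1 : g ≤ 1 := by nlinarith
  have hg2 : -1 ≤ g := by nlinarith
  have hdet : 4 - g ^ 2 > 0 := by nlinarith
  have h2g : 2 - g > 0 := by linarith
  -- Cramer's rule for the left null vector at c = 0, that is, for `hb1` and `hb2`; the determinant
  -- is 4 - g², with g = cos θ.
  set l₁ := -(2 * s * C) * (2 / d₂ + g / d₁) / (4 - g ^ 2) with hl₁
  set l₂ := -(2 * s * C) * (2 / d₁ + g / d₂) / (4 - g ^ 2) with hl₂
  set μ := (1 / d₁ + 1 / d₂) * C / (2 - g) with hμ
  have hμ0 : 0 < μ := by positivity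
  -- `hb1` and `hb2` cancel the terms of ψ' linear in e₁, e₂ at c = 0; `hb3` identifies the damping
  -- rate of ψ per unit of c, using 2 - g - 2s² = 1.
  have hb1 : -2 * l₁ + g * l₂ = 2 * s * C / d₂ := by
    rw [hl₁, hl₂]; field_simp; ring
  have hb2 : g * l₁ - 2 * l₂ = 2 * s * C / d₁ := by
    rw [hl₁, hl₂]; field_simp; ring
  have hb3 : C * (1 / d₁ + 1 / d₂) + s * (l₁ + l₂) = μ := by
    have hsum : l₁ + l₂ = -(2 * s * C) * (1 / d₁ + 1 / d₂) / (2 - g) := by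
      rw [eq_div_iff h2g.ne']
      linear_combination -hb1 - hb2
    rw [hsum, hμ, eq_div_iff h2g.ne', add_mul]
    have : s * (-(2 * s * C) * (1 / d₁ + 1 / d₂) / (2 - g)) * (2 - g) =
      s * (-(2 * s * C) * (1 / d₁ + 1 / d₂)) := by field_simp
    rw [this, hg]
    linear_combination -(C * (1 / d₁ + 1 / d₂)) * hCs
  clear_value l₁ l₂ μ g
  set B := |l₁| + |l₂| with hB
  have hB0 : 0 ≤ B := by positivity
  set G := 1 + μ * B with hG
  have hG0 : 0 < G := by positivity
  -- The two bounds let the damping of e₁, e₂ absorb, respectively, the term c s q (e₁ + e₂) and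
  -- what Young's inequality leaves of the cross term between ψ and e₁, e₂.
  refine ⟨l₁, l₂, min (1 / (8 * (B + 1))) (μ / (4 * G ^ 2)), by positivity, fun c hc hc0 => ?_⟩
  have hc1 : c * B ≤ 1 / 8 := by
    have := (hc0.trans_le (min_le_left _ _)).le
    rw [le_div_iff₀ (by positivity)] at this
    nlinarith
  have hc2 : c * G ^ 2 ≤ μ / 4 := by
    have := (hc0.trans_le (min_le_right _ _)).le
    rw [le_div_iff₀ (by positivity)] at this
    nlinarith
  refine ⟨min (1 / 4) (c * μ / 2), by positivity, fun e₁ e₂ σ => ?_⟩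
  set ψ := σ + l₁ * e₁ + l₂ * e₂ with hψ
  set E := |e₁| + |e₂| with hE
  have hE0 : 0 ≤ E := by positivity
  have hEl : e₁ ^ 2 + e₂ ^ 2 ≤ E ^ 2 := by
    rw [hE, ← sq_abs e₁, ← sq_abs e₂]
    linarith [mul_nonneg (abs_nonneg e₁) (abs_nonneg e₂), add_sq |e₁| |e₂|]
  have hEu : E ^ 2 ≤ 2 * (e₁ ^ 2 + e₂ ^ 2) := by
    rw [hE, ← sq_abs e₁, ← sq_abs e₂]
    linarith [sq_nonneg (|e₁| - |e₂|), sub_sq |e₁| |e₂|, add_sq |e₁| |e₂|]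
  set q := l₁ * e₁ + l₂ * e₂ with hq
  have hqB : |q| ≤ B * E := by
    refine (abs_add_le _ _).trans ?_
    rw [abs_mul, abs_mul, hB, hE]
    linarith [mul_nonneg (abs_nonneg l₁) (abs_nonneg e₂),
      mul_nonneg (abs_nonneg l₂) (abs_nonneg e₁)]
  have hsum : |e₁ + e₂| ≤ E := abs_add_le _ _
  have key : e₁ * (-2 * e₁ + e₂ * g - c * (s * σ)) + e₂ * (e₁ * g - 2 * e₂ - c * (s * σ)) +
        ψ * (-((e₁ * (2 * s * C) + c * (C * σ)) / d₂) - (e₂ * (2 * s * C) + c * (C * σ)) / d₁ +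
            l₁ * (-2 * e₁ + e₂ * g - c * (s * σ)) + l₂ * (e₁ * g - 2 * e₂ - c * (s * σ))) =
      (-2 * e₁ ^ 2 - 2 * e₂ ^ 2 + 2 * g * (e₁ * e₂)) - c * μ * ψ ^ 2 +
        c * (ψ * (μ * q - s * (e₁ + e₂))) + c * (s * (q * (e₁ + e₂))) := by
    have hσ : σ = ψ - q := by rw [hψ, hq]; ring
    rw [hσ]
    linear_combination ψ * e₁ * hb1 + ψ * e₂ * hb2 - ψ * c * (ψ - q) * hb3
  rw [key]
  have t1 : -2 * e₁ ^ 2 - 2 * e₂ ^ 2 + 2 * g * (e₁ * e₂) ≤ -(e₁ ^ 2 + e₂ ^ 2) := by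
    linarith [mul_nonneg (by linarith : 0 ≤ 1 + g) (sq_nonneg (e₁ - e₂)),
      mul_nonneg (by linarith : 0 ≤ 1 - g) (sq_nonneg (e₁ + e₂))]
  have t2 : |μ * q - s * (e₁ + e₂)| ≤ G * E := by
    refine (abs_sub _ _).trans ((add_le_add (abs_mul_le_mul (abs_of_pos hμ0).le hqB)
      (abs_mul_le_mul hs1 hsum)).trans_eq ?_)
    rw [hG]; ring
  have t3 : ψ * (μ * q - s * (e₁ + e₂)) ≤ |ψ| * (G * E) :=
    (le_abs_self _).trans (abs_mul_le_mul le_rfl t2)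
  have t4 : s * (q * (e₁ + e₂)) ≤ B * E ^ 2 :=
    (le_abs_self _).trans ((abs_mul_le_mul hs1 (abs_mul_le_mul hqB hsum)).trans_eq (by ring))
  -- Young's inequality, weighted to spend half of the damping μψ².
  have t5 : |ψ| * (G * E) ≤ μ / 2 * ψ ^ 2 + (G * E) ^ 2 / (2 * μ) := by
    have : 0 ≤ (μ * |ψ| - G * E) ^ 2 / (2 * μ) := by positivity
    have h2 : (μ * |ψ| - G * E) ^ 2 / (2 * μ) =
        μ / 2 * |ψ| ^ 2 + (G * E) ^ 2 / (2 * μ) - |ψ| * (G * E) := by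
      field_simp; ring
    rw [sq_abs] at h2
    linarith
  have t6 : c * ((G * E) ^ 2 / (2 * μ)) ≤ E ^ 2 / 8 := by
    have : c * ((G * E) ^ 2 / (2 * μ)) = (c * G ^ 2) * (E ^ 2 / (2 * μ)) := by ring
    rw [this]
    refine (mul_le_mul_of_nonneg_right hc2 (by positivity)).trans_eq ?_
    field_simp; ring
  have t7 := mul_le_mul_of_nonneg_left (t3.trans t5) hc.le
  have t8 := mul_le_mul_of_nonneg_left t4 hc.le
  have t9 := mul_le_mul_of_nonneg_right hc1 (sq_nonneg E)
  have m1 := mul_le_mul_of_nonneg_right (min_le_left (1 / 4) (c * μ / 2))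
    (by positivity : 0 ≤ e₁ ^ 2 + e₂ ^ 2)
  have m2 := mul_le_mul_of_nonneg_right (min_le_right (1 / 4) (c * μ / 2)) (sq_nonneg ψ)
  linarith

/-- The Lyapunov derivative is its quadratic part up to a cubic error. -/
lemma lyapunovDeriv_le_add_cubic {d₁ d₂ C s c : ℝ} (hd₁ : 0 < d₁) (hd₂ : 0 < d₂)
    (hCs : C ^ 2 + s ^ 2 = 1) (hc : 0 < c) (l₁ l₂ : ℝ) :
    ∃ M > (0 : ℝ), ∀ e₁ e₂ σ κ N : ℝ, σ ^ 2 + κ ^ 2 = 1 → 0 ≤ κ → |e₁| ≤ N → |e₂| ≤ N → |σ| ≤ N →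
      N ≤ 1 → |e₁| ≤ d₁ / 2 → |e₂| ≤ d₂ / 2 →
      lyapunovDeriv d₁ d₂ C s c l₁ l₂ e₁ e₂ σ κ ≤
        2 * (e₁ * (-2 * e₁ + e₂ * (C ^ 2 - s ^ 2) - c * (s * σ)) +
        e₂ * (e₁ * (C ^ 2 - s ^ 2) - 2 * e₂ - c * (s * σ)) +
        (σ + l₁ * e₁ + l₂ * e₂) *
          (-((e₁ * (2 * s * C) + c * (C * σ)) / d₂) - (e₂ * (2 * s * C) + c * (C * σ)) / d₁ +
            l₁ * (-2 * e₁ + e₂ * (C ^ 2 - s ^ 2) - c * (s * σ)) +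
            l₂ * (e₁ * (C ^ 2 - s ^ 2) - 2 * e₂ - c * (s * σ)))) + M * N ^ 3 := by
  have hs1 : |s| ≤ 1 := abs_le_of_sq_le_sq (by nlinarith) (by norm_num)
  have hC1 : |C| ≤ 1 := abs_le_of_sq_le_sq (by nlinarith) (by norm_num)
  have hg1 : |C ^ 2 - s ^ 2| ≤ 1 := abs_le.2 ⟨by nlinarith, by nlinarith⟩
  have hh1 : |2 * s * C| ≤ 1 :=
    abs_le.2 ⟨by nlinarith [sq_nonneg (C + s)], by nlinarith [sq_nonneg (C - s)]⟩
  have hca : |c| ≤ c := (abs_of_pos hc).le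
  set m := 2 + c with hm
  have hm0 : 0 < m := by positivity
  set n := (2 * m / d₂ + 2 * m / d₂ ^ 2) + (2 * m / d₁ + 2 * m / d₁ ^ 2) with hn
  have hn0 : 0 < n := by positivity
  set P := n + (m / d₁ + m / d₂) with hP
  have hP0 : 0 < P := by positivity
  set B := |l₁| + |l₂| with hB
  have hB0 : 0 ≤ B := by positivity
  refine ⟨2 * (m + m + (1 + B) * ((n + P) + B * m) + P), by positivity, ?_⟩
  intro e₁ e₂ σ κ N hσκ hκ h1 h2 h3 hN1 hd1 hd2
  have hN0 : 0 ≤ N := (abs_nonneg _).trans h1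
  have hNN : N ^ 2 ≤ N := by nlinarith
  have hκ1 : κ ≤ 1 := by nlinarith [sq_nonneg σ]
  -- For 0 ≤ κ ≤ 1, 1 - κ ≤ 1 - κ² = σ²: the cosine error is of second order.
  have hk2 : |1 - κ| ≤ N ^ 2 := by
    rw [abs_of_nonneg (by linarith)]
    have : σ ^ 2 ≤ N ^ 2 := by rw [← sq_abs σ]; exact pow_le_pow_left₀ (abs_nonneg _) h3 2
    nlinarith
  have hkN : |1 - κ| ≤ N := hk2.trans hNN
  unfold lyapunovDeriv
  set E₁ := errDeriv₁ C s c e₁ e₂ σ κ with hE₁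
  set E₂ := errDeriv₂ C s c e₁ e₂ σ κ with hE₂
  set Φ := angleDeriv d₁ d₂ C s c e₁ e₂ σ κ with hΦ
  rw [errDeriv₁] at hE₁
  rw [errDeriv₂] at hE₂
  rw [angleDeriv] at hΦ
  set L₁ := -2 * e₁ + e₂ * (C ^ 2 - s ^ 2) - c * (s * σ) with hL₁
  set L₂ := e₁ * (C ^ 2 - s ^ 2) - 2 * e₂ - c * (s * σ) with hL₂
  set A₀ := e₁ * (2 * s * C) + c * (C * σ) with hA₀
  set B₀ := e₂ * (2 * s * C) + c * (C * σ) with hB₀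
  have hr₁ : |E₁ - L₁| ≤ m * N ^ 2 := by
    have : E₁ - L₁ = -(e₂ * ((C ^ 2 - s ^ 2) * (1 - κ)) + (2 * s * C) * (e₂ * σ) +
        c * (C * (1 - κ))) := by rw [hE₁, hL₁]; ring
    rw [this, abs_neg]
    refine (abs_add_three _ _ _).trans ((add_le_add_three
      (abs_mul_le_mul h2 (abs_mul_le_mul hg1 hkN)) (abs_mul_le_mul hh1 (abs_mul_le_mul h2 h3))
      (abs_mul_le_mul hca (abs_mul_le_mul hC1 hk2))).trans_eq ?_)
    rw [hm]; ring
  have hr₂ : |E₂ - L₂| ≤ m * N ^ 2 := by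
    have : E₂ - L₂ = -(e₁ * ((C ^ 2 - s ^ 2) * (1 - κ)) + (2 * s * C) * (e₁ * σ) +
        c * (C * (1 - κ))) := by rw [hE₂, hL₂]; ring
    rw [this, abs_neg]
    refine (abs_add_three _ _ _).trans ((add_le_add_three
      (abs_mul_le_mul h1 (abs_mul_le_mul hg1 hkN)) (abs_mul_le_mul hh1 (abs_mul_le_mul h1 h3))
      (abs_mul_le_mul hca (abs_mul_le_mul hC1 hk2))).trans_eq ?_)
    rw [hm]; ring
  have hlin : ∀ e, |e| ≤ N → |e * (2 * s * C) + c * (C * σ)| ≤ m * N := by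
    intro e he
    refine (abs_add_le _ _).trans ((add_le_add (abs_mul_le_mul he hh1)
      (abs_mul_le_mul hca (abs_mul_le_mul hC1 h3))).trans ?_)
    rw [hm]; linarith
  have hnum : ∀ e, |e| ≤ N → |(e * (2 * s * C * κ + (C ^ 2 - s ^ 2) * σ) +
      c * (C * σ - s * (1 - κ))) - (e * (2 * s * C) + c * (C * σ))| ≤ m * N ^ 2 := by
    intro e he
    have : (e * (2 * s * C * κ + (C ^ 2 - s ^ 2) * σ) +
      c * (C * σ - s * (1 - κ))) - (e * (2 * s * C) + c * (C * σ)) =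
      -(e * ((2 * s * C) * (1 - κ)) + -((C ^ 2 - s ^ 2) * (e * σ)) + c * (s * (1 - κ))) := by ring
    rw [this, abs_neg]
    refine (abs_add_three _ _ _).trans ((add_le_add_three
      (abs_mul_le_mul he (abs_mul_le_mul hh1 hkN))
      ((abs_neg _).trans_le (abs_mul_le_mul hg1 (abs_mul_le_mul he h3)))
      (abs_mul_le_mul hca (abs_mul_le_mul hs1 hk2))).trans_eq ?_)
    rw [hm]; ring
  have hr₃ : |Φ - (-(A₀ / d₂) - B₀ / d₁)| ≤ n * N ^ 2 := by
    have q1 := abs_div_sub_div_le hd₂ hd2 h2 (hnum e₁ h1) (hlin e₁ h1)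
    have q2 := abs_div_sub_div_le hd₁ hd1 h1 (hnum e₂ h2) (hlin e₂ h2)
    rw [hΦ, hn, add_mul]
    refine le_trans (le_of_eq ?_) ((abs_add_le _ _).trans (add_le_add q1 q2))
    rw [← abs_neg, hA₀, hB₀]
    congr 1; ring
  have hL₃ : |-(A₀ / d₂) - B₀ / d₁| ≤ (m / d₁ + m / d₂) * N := by
    refine (abs_sub _ _).trans ?_
    rw [abs_neg, abs_div, abs_div, abs_of_pos hd₁, abs_of_pos hd₂]
    have q1 := div_le_div_of_nonneg_right (hlin e₁ h1) hd₂.le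
    have q2 := div_le_div_of_nonneg_right (hlin e₂ h2) hd₁.le
    refine (add_le_add q1 q2).trans_eq ?_
    ring
  have hΦP : |Φ| ≤ P * N := by
    have : Φ = (Φ - (-(A₀ / d₂) - B₀ / d₁)) + (-(A₀ / d₂) - B₀ / d₁) := by ring
    rw [this]
    refine (abs_add_le _ _).trans ((add_le_add hr₃ hL₃).trans ?_)
    rw [hP]
    have := mul_le_mul_of_nonneg_left hNN hn0.le
    linarith
  set L₃ := -(A₀ / d₂) - B₀ / d₁ with hL₃'
  clear_value E₁ E₂ Φ L₁ L₂ L₃ A₀ B₀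
  have hκΦ : |κ * Φ - L₃| ≤ (n + P) * N ^ 2 := by
    have : κ * Φ - L₃ = (Φ - L₃) + -((1 - κ) * Φ) := by ring
    rw [this]
    refine (abs_add_le _ _).trans ((add_le_add hr₃
      ((abs_neg _).trans_le (abs_mul_le_mul hkN hΦP))).trans_eq ?_)
    ring
  have hψ : |σ + l₁ * e₁ + l₂ * e₂| ≤ (1 + B) * N := by
    refine (abs_add_three _ _ _).trans ((add_le_add_three h3
      (abs_mul_le_mul le_rfl h1) (abs_mul_le_mul le_rfl h2)).trans_eq ?_)
    rw [hB]; ring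
  have hin : |(κ * Φ - L₃) + l₁ * (E₁ - L₁) + l₂ * (E₂ - L₂)| ≤ ((n + P) + B * m) * N ^ 2 := by
    refine (abs_add_three _ _ _).trans ((add_le_add_three hκΦ
      (abs_mul_le_mul le_rfl hr₁) (abs_mul_le_mul le_rfl hr₂)).trans_eq ?_)
    rw [hB]; ring
  have w1 := (le_abs_self _).trans (abs_mul_le_mul h1 hr₁)
  have w2 := (le_abs_self _).trans (abs_mul_le_mul h2 hr₂)
  have w3 := (le_abs_self _).trans (abs_mul_le_mul hψ hin)
  have w4 := (le_abs_self _).trans (abs_mul_le_mul hkN (abs_mul_le_mul h3 hΦP))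
  linarith

/-- The reduced dynamics are exponentially stable: for small gains the Lyapunov function decays
where it is small. -/
lemma exists_lyapunovDeriv_le {d₁ d₂ C s : ℝ} (hd₁ : 0 < d₁) (hd₂ : 0 < d₂) (hC : 0 < C)
    (hCs : C ^ 2 + s ^ 2 = 1) :
    ∃ l₁ l₂ : ℝ, ∃ c₀ > (0 : ℝ), ∀ c : ℝ, 0 < c → c < c₀ →
      ∃ ρ > (0 : ℝ), ∃ a > (0 : ℝ), ∃ K > (0 : ℝ), ∀ e₁ e₂ σ κ : ℝ,
        lyapunov l₁ l₂ e₁ e₂ σ κ < ρ → |e₁| < d₁ / 2 ∧ |e₂| < d₂ / 2 ∧ (σ ^ 2 + κ ^ 2 = 1 →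
          0 ≤ κ ∧ e₁ ^ 2 + e₂ ^ 2 + σ ^ 2 ≤ K * lyapunov l₁ l₂ e₁ e₂ σ κ ∧
          lyapunovDeriv d₁ d₂ C s c l₁ l₂ e₁ e₂ σ κ ≤ -a * lyapunov l₁ l₂ e₁ e₂ σ κ) := by
  obtain ⟨l₁, l₂, c₀, hc₀, H⟩ := quadratic_lyapunov hd₁ hd₂ hC hCs
  refine ⟨l₁, l₂, c₀, hc₀, fun c hc hcc => ?_⟩
  obtain ⟨m, hm, H⟩ := H c hc hcc
  obtain ⟨M, hM, HM⟩ := lyapunovDeriv_le_add_cubic hd₁ hd₂ hCs hc l₁ l₂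
  set K := 3 + 4 * (l₁ ^ 2 + l₂ ^ 2) with hK
  have hK0 : 0 < K := by positivity
  -- The entries of the threshold force, in order: κ ≥ 0, both distances within half of their
  -- targets, N ≤ 1, and N ≤ m / (M K), where N is the norm of (e₁, e₂, σ). The last makes the cubic
  -- error at most m S, half of the quadratic decay 2 m S.
  refine ⟨min (min 1 (min ((d₁ / 2) ^ 2) ((d₂ / 2) ^ 2))) (min (1 / K) ((m / (M * K)) ^ 2 / K)),
    by positivity, m / (1 + K), by positivity, K, hK0, ?_⟩
  intro e₁ e₂ σ κ hV
  obtain ⟨hVa, hVb⟩ := lt_min_iff.1 hV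
  obtain ⟨hV1, hVd⟩ := lt_min_iff.1 hVa
  obtain ⟨hVd1, hVd2⟩ := lt_min_iff.1 hVd
  obtain ⟨hVK, hVM⟩ := lt_min_iff.1 hVb
  set V := lyapunov l₁ l₂ e₁ e₂ σ κ with hVdef
  rw [lyapunov] at hVdef
  set ψ := σ + l₁ * e₁ + l₂ * e₂ with hψ
  have p1 := sq_nonneg e₁
  have p2 := sq_nonneg e₂
  have p3 := sq_nonneg ψ
  have p4 := sq_nonneg (1 - κ)
  refine ⟨abs_lt_of_sq_lt_sq (by linarith) (by positivity),
    abs_lt_of_sq_lt_sq (by linarith) (by positivity), fun hσκ => ?_⟩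
  have hd1 : |e₁| < d₁ / 2 := abs_lt_of_sq_lt_sq (by linarith) (by positivity)
  have hd2 : |e₂| < d₂ / 2 := abs_lt_of_sq_lt_sq (by linarith) (by positivity)
  have hk : |1 - κ| < 1 := abs_lt_of_sq_lt_sq (by linarith) (by positivity)
  have hκ : 0 ≤ κ := by linarith [(abs_lt.1 hk).2]
  set S := e₁ ^ 2 + e₂ ^ 2 + ψ ^ 2 with hS
  have hSV : S ≤ V := by linarith
  have hS0 : 0 ≤ S := by positivity
  set N2 := e₁ ^ 2 + e₂ ^ 2 + σ ^ 2 with hN2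
  have hN20 : 0 ≤ N2 := by positivity
  have hNS : N2 ≤ K * S := by
    have hq : (l₁ * e₁ + l₂ * e₂) ^ 2 ≤ (l₁ ^ 2 + l₂ ^ 2) * (e₁ ^ 2 + e₂ ^ 2) := by
      linarith [sq_nonneg (l₁ * e₂ - l₂ * e₁)]
    have hσ2 : σ ^ 2 ≤ 2 * ψ ^ 2 + 2 * (l₁ * e₁ + l₂ * e₂) ^ 2 := by
      have : 2 * ψ ^ 2 + 2 * (l₁ * e₁ + l₂ * e₂) ^ 2 - σ ^ 2 =
        (ψ + (l₁ * e₁ + l₂ * e₂)) ^ 2 := by rw [hψ]; ring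
      linarith [sq_nonneg (ψ + (l₁ * e₁ + l₂ * e₂))]
    have hl : 0 ≤ (l₁ ^ 2 + l₂ ^ 2) * S := by positivity
    have hl2 : 0 ≤ (l₁ ^ 2 + l₂ ^ 2) * ψ ^ 2 := by positivity
    have hl3 : 0 ≤ (l₁ ^ 2 + l₂ ^ 2) * (e₁ ^ 2 + e₂ ^ 2) := by positivity
    rw [hK, hN2, hS]
    linarith
  have hKV : K * S ≤ K * V := mul_le_mul_of_nonneg_left hSV hK0.le
  have hN1 : N2 ≤ 1 := by
    rw [lt_div_iff₀ hK0] at hVK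
    linarith
  have hNM : N2 ≤ (m / (M * K)) ^ 2 := by
    rw [lt_div_iff₀ hK0] at hVM
    linarith
  have hsq : √N2 ^ 2 = N2 := Real.sq_sqrt hN20
  have hσ0 := sq_nonneg σ
  have hκ1 : κ ≤ 1 := (abs_le.1 (abs_le_of_sq_le_sq (by linarith) zero_le_one)).2
  -- (1 - κ)² ≤ 1 - κ² = σ², so the extra term of V is dominated by the quadratic part.
  have hk2 : (1 - κ) ^ 2 ≤ N2 := by
    have h1 : 0 ≤ (1 - κ) * κ := mul_nonneg (by linarith) hκ
    linarith
  have hVS : V ≤ (1 + K) * S := by linarith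
  refine ⟨hκ, hNS.trans hKV, ?_⟩
  have key := HM e₁ e₂ σ κ √N2 hσκ hκ (Real.abs_le_sqrt (by linarith))
    (Real.abs_le_sqrt (by linarith)) (Real.abs_le_sqrt (by linarith))
    (Real.sqrt_le_one.2 hN1) hd1.le hd2.le
  have hq := H e₁ e₂ σ
  have hsm : √N2 ≤ m / (M * K) := Real.sqrt_le_iff.2 ⟨by positivity, hNM⟩
  have hcub : M * √N2 ^ 3 ≤ m * S := by
    calc M * √N2 ^ 3 = M * √N2 * N2 := by rw [pow_succ' √N2 2, hsq, mul_assoc]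
      _ ≤ M * (m / (M * K)) * (K * S) := mul_le_mul (mul_le_mul_of_nonneg_left hsm hM.le) hNS hN20 (by positivity)
      _ = m * S := by field_simp
  have hfin : m / (1 + K) * V ≤ m * S := by
    rw [div_mul_eq_mul_div, div_le_iff₀ (by positivity)]
    linarith [mul_le_mul_of_nonneg_left hVS hm.le]
  linarith

/-! ### Two facts on differential equations: a bootstrap for decay, and global existence -/

/-- A nonnegative function that decays exponentially as long as it is below a threshold `ρ`, and
starts below `ρ`, decays exponentially forever. -/
lemma le_mul_exp_of_deriv_le_of_lt {v v' : ℝ → ℝ} {ρ a T : ℝ} (ha : 0 ≤ a)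
    (hv : ContinuousOn v (Ico 0 T)) (hv₀ : v 0 < ρ) (hpos : 0 ≤ v 0)
    (hd : ∀ t ∈ Ico 0 T, v t < ρ → HasDerivWithinAt v (v' t) (Ico 0 T) t)
    (hb : ∀ t ∈ Ico 0 T, v t < ρ → v' t ≤ -a * v t) :
    ∀ t ∈ Ico 0 T, v t ≤ v 0 * Real.exp (-a * t) := by
  -- Grönwall needs the derivative only on [0, t), yet bounds `v` at `t` itself; a first time with v
  -- ≥ ρ is thus contradictory.
  have aux : ∀ t ∈ Ico 0 T, (∀ τ ∈ Ico 0 t, v τ < ρ) → v t ≤ v 0 * Real.exp (-a * t) := by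
    intro t ht hlt
    have hsub : Icc 0 t ⊆ Ico 0 T := fun τ hτ => ⟨hτ.1, hτ.2.trans_lt ht.2⟩
    have := le_gronwallBound_of_liminf_deriv_right_le (f := v) (f' := v') (δ := v 0) (K := -a)
      (ε := 0) (a := 0) (b := t) (hv.mono hsub) ?_ le_rfl ?_ t ⟨ht.1, le_rfl⟩
    · simpa [gronwallBound_ε0] using this
    · intro τ hτ r hr
      have hτ' : τ ∈ Ico 0 T := hsub ⟨hτ.1, hτ.2.le⟩
      have h1 : HasDerivWithinAt v (v' τ) (Ici τ) τ := by
        refine (hd τ hτ' (hlt τ hτ)).mono_of_mem_nhdsWithin ?_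
        exact Filter.mem_of_superset (Ico_mem_nhdsGE hτ'.2) (Ico_subset_Ico_left hτ'.1)
      exact h1.liminf_right_slope_le hr
    · intro τ hτ
      simpa using hb τ (hsub ⟨hτ.1, hτ.2.le⟩) (hlt τ hτ)
  intro t ht
  refine aux t ht ?_
  by_contra! hcon
  obtain ⟨τ₀, hτ₀, hτ₀ρ⟩ := hcon
  have hcont : ContinuousOn v (Icc 0 t) :=
    hv.mono fun τ hτ => ⟨hτ.1, hτ.2.trans_lt ht.2⟩
  set S := Icc 0 t ∩ v ⁻¹' Ici ρ with hS
  have hSc : IsClosed S := hcont.preimage_isClosed_of_isClosed isClosed_Icc isClosed_Ici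
  have hSn : S.Nonempty := ⟨τ₀, ⟨hτ₀.1, hτ₀.2.le⟩, hτ₀ρ⟩
  have hSb : BddBelow S := ⟨0, fun τ hτ => hτ.1.1⟩
  have hm := hSc.csInf_mem hSn hSb
  have h1 := aux (sInf S) ⟨hm.1.1, hm.1.2.trans_lt ht.2⟩ (by
    intro τ hτ
    by_contra! h
    exact absurd (csInf_le hSb (⟨⟨hτ.1, hτ.2.le.trans hm.1.2⟩, h⟩ : τ ∈ S)) (not_le.2 hτ.2))
  have h2 : Real.exp (-a * sInf S) ≤ 1 := Real.exp_le_one_iff.2 (by nlinarith [hm.1.1])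
  have h3 : ρ ≤ v (sInf S) := hm.2
  nlinarith

/-- A bounded Lipschitz vector field has global solutions. -/
lemma exists_hasDerivAt_of_lipschitzWith_of_bounded {E : Type*} [NormedAddCommGroup E]
    [NormedSpace ℝ E] [CompleteSpace E] {f : E → E} {K L : NNReal} (hf : LipschitzWith K f)
    (hL : ∀ x, ‖f x‖ ≤ L) (x₀ : E) :
    ∃ x : ℝ → E, x 0 = x₀ ∧ ∀ t, HasDerivAt x (f (x t)) t := by
  have local_sol : ∀ n : ℕ, ∃ α : ℝ → E, α 0 = x₀ ∧
      ∀ t ∈ Ioo (-(n : ℝ)) n, HasDerivAt α (f (α t)) t := by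
    intro n
    have h0 : (0 : ℝ) ∈ Icc (-(n : ℝ)) n := by simp
    -- A field bounded by L cannot leave the ball of radius L n within time n, so Picard–Lindelöf
    -- applies on all of [-n, n].
    have hP : IsPicardLindelof (fun _ => f) (⟨0, h0⟩ : Icc (-(n : ℝ)) n) x₀ (L * n) 0 L K :=
      IsPicardLindelof.of_time_independent (fun x _ => hL x) hf.lipschitzOnWith (by simp)
    obtain ⟨α, hα0, hα⟩ := hP.exists_eq_forall_mem_Icc_hasDerivWithinAt₀
    exact ⟨α, hα0, fun t ht => (hα t (Ioo_subset_Icc_self ht)).hasDerivAt (Icc_mem_nhds ht.1 ht.2)⟩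
  choose α hα0 hα using local_sol
  have agree : ∀ m n : ℕ, m ≤ n → EqOn (α m) (α n) (Ioo (-(m : ℝ)) m) := by
    intro m n hmn
    rcases Nat.eq_zero_or_pos m with rfl | hm
    · intro t ht; simp at ht
    have hm' : (0 : ℝ) < m := by exact_mod_cast hm
    have hmn' : (m : ℝ) ≤ n := by exact_mod_cast hmn
    refine ODE_solution_unique_of_mem_Ioo (v := fun _ => f) (s := fun _ => univ) (K := K) (t₀ := 0)
      (fun t _ => hf.lipschitzOnWith) (by simp [hm']) (fun t ht => ⟨hα m t ht, mem_univ _⟩)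
      (fun t ht => ⟨hα n t ⟨by linarith [ht.1], by linarith [ht.2]⟩, mem_univ _⟩)
      (by rw [hα0, hα0])
  have key : ∀ n : ℕ, EqOn (fun t : ℝ => α (⌈|t|⌉₊ + 1) t) (α n) (Ioo (-(n : ℝ)) n) := by
    intro n t ht
    have h1 : |t| < ((⌈|t|⌉₊ + 1 : ℕ) : ℝ) := by
      push_cast; linarith [Nat.le_ceil |t|]
    rcases le_total (⌈|t|⌉₊ + 1) n with h | h
    · exact agree _ _ h (abs_lt.1 h1)
    · exact (agree _ _ h ht).symm
  -- The `+ 1` puts `t` strictly inside the interval even when |t| is an integer.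
  refine ⟨fun t => α (⌈|t|⌉₊ + 1) t, hα0 _, fun t => ?_⟩
  have h1 : |t| < ((⌈|t|⌉₊ + 1 : ℕ) : ℝ) := by
    push_cast; linarith [Nat.le_ceil |t|]
  have h2 := abs_lt.1 h1
  exact (hα _ t h2).congr_of_eventuallyEq
    (Filter.eventuallyEq_of_mem (Ioo_mem_nhds h2.1 h2.2) (key _))

/-! ### Truncated unit vectors -/

/-- The vector `z / ‖z‖`, with the denominator cut off below at `δ`. -/
noncomputable def truncUnit (δ : ℝ) (z : Plane) : Plane := (max δ ‖z‖)⁻¹ • z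

lemma truncUnit_eq_unitVec {δ : ℝ} {z : Plane} (h : δ ≤ ‖z‖) : truncUnit δ z = unitVec z := by
  rw [truncUnit, unitVec, max_eq_right h]

lemma norm_truncUnit_le_one {δ : ℝ} (hδ : 0 < δ) (z : Plane) : ‖truncUnit δ z‖ ≤ 1 := by
  have : 0 < max δ ‖z‖ := lt_max_of_lt_left hδ
  rw [truncUnit, norm_smul, norm_inv, Real.norm_of_nonneg this.le, inv_mul_le_iff₀ this, mul_one]
  exact le_max_right _ _

lemma norm_truncUnit_sub_le {δ : ℝ} (hδ : 0 < δ) (z w : Plane) :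
    ‖truncUnit δ z - truncUnit δ w‖ ≤ 2 / δ * ‖z - w‖ := by
  set M := max δ ‖z‖ with hM
  have hδM : δ ≤ M := le_max_left _ _
  have hM0 : 0 < M := hδ.trans_le hδM
  set N := max δ ‖w‖ with hN
  have hN0 : 0 < N := hδ.trans_le (le_max_left _ _)
  -- Each summand is at most ‖z - w‖ / δ: the second because the cut-off norm is 1-Lipschitz and
  -- `truncUnit δ w` has norm at most 1.
  have e : truncUnit δ z - truncUnit δ w = M⁻¹ • (z - w) + (M⁻¹ * (N - M)) • truncUnit δ w := by
    rw [truncUnit, truncUnit, ← hM, ← hN, smul_smul, smul_sub]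
    have : M⁻¹ * (N - M) * N⁻¹ = M⁻¹ - N⁻¹ := by field_simp
    rw [this, sub_smul]
    abel
  have hNM : |N - M| ≤ ‖z - w‖ := by
    have h1 := abs_max_sub_max_le_max δ ‖w‖ δ ‖z‖
    have h2 := abs_norm_sub_norm_le w z
    rw [sub_self, abs_zero, max_eq_right (abs_nonneg (‖w‖ - ‖z‖)), ← hM, ← hN] at h1
    rw [norm_sub_rev z w]
    exact h1.trans h2
  have hi : M⁻¹ ≤ δ⁻¹ := inv_anti₀ hδ hδM
  rw [e]
  refine (norm_add_le _ _).trans ?_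
  rw [norm_smul, norm_smul, norm_mul, norm_inv, Real.norm_of_nonneg hM0.le, Real.norm_eq_abs]
  have h1 : M⁻¹ * ‖z - w‖ ≤ δ⁻¹ * ‖z - w‖ := mul_le_mul_of_nonneg_right hi (norm_nonneg _)
  have h2 : M⁻¹ * |N - M| * ‖truncUnit δ w‖ ≤ δ⁻¹ * ‖z - w‖ * 1 :=
    mul_le_mul (mul_le_mul hi hNM (abs_nonneg _) (by positivity)) (norm_truncUnit_le_one hδ w)
      (norm_nonneg _) (by positivity)
  refine (add_le_add h1 h2).trans_eq ?_
  ring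

/-! ### Sine and cosine of the angle error -/

lemma norm_plane_sq (z : Plane) : ‖z‖ ^ 2 = z 0 ^ 2 + z 1 ^ 2 := by
  simp [EuclideanSpace.norm_sq_eq, Fin.sum_univ_two]

lemma norm_unitVec {z : Plane} (hz : z ≠ 0) : ‖unitVec z‖ = 1 := by
  rw [unitVec, norm_smul, norm_inv, norm_norm, inv_mul_cancel₀ (norm_ne_zero_iff.2 hz)]

/-- The cosine of the angle from `W(θ) u` to `v`, for unit vectors `u` and `v`. -/
noncomputable def cosErr (θ : ℝ) (u v : Plane) : ℝ :=
  (u 0 * v 0 + u 1 * v 1) * Real.cos θ + (u 0 * v 1 - u 1 * v 0) * Real.sin θ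

/-- The sine of the angle from `W(θ) u` to `v`, for unit vectors `u` and `v`. -/
noncomputable def sinErr (θ : ℝ) (u v : Plane) : ℝ :=
  (u 0 * v 1 - u 1 * v 0) * Real.cos θ - (u 0 * v 0 + u 1 * v 1) * Real.sin θ

lemma sinErr_sq_add_cosErr_sq (θ : ℝ) (u v : Plane) :
    sinErr θ u v ^ 2 + cosErr θ u v ^ 2 = (‖u‖ * ‖v‖) ^ 2 := by
  rw [mul_pow, norm_plane_sq, norm_plane_sq, sinErr, cosErr]
  linear_combination (u 0 ^ 2 + u 1 ^ 2) * (v 0 ^ 2 + v 1 ^ 2) * Real.sin_sq_add_cos_sq θ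

lemma rotMatrix_mulVec_zero (θ : ℝ) (v : Plane) :
    matVec (rotMatrix θ) v 0 = Real.cos θ * v 0 - Real.sin θ * v 1 := by
  simp [matVec, rotMatrix, dotProduct, Fin.sum_univ_two]
  ring

lemma rotMatrix_mulVec_one (θ : ℝ) (v : Plane) :
    matVec (rotMatrix θ) v 1 = Real.sin θ * v 0 + Real.cos θ * v 1 := by
  simp [matVec, rotMatrix, dotProduct, Fin.sum_univ_two]

lemma rotMatrix_transpose_mulVec_zero (θ : ℝ) (v : Plane) :
    matVec (rotMatrix θ).transpose v 0 = Real.cos θ * v 0 + Real.sin θ * v 1 := by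
  simp [matVec, rotMatrix, Matrix.transpose]

lemma rotMatrix_transpose_mulVec_one (θ : ℝ) (v : Plane) :
    matVec (rotMatrix θ).transpose v 1 = -Real.sin θ * v 0 + Real.cos θ * v 1 := by
  simp [matVec, rotMatrix, Matrix.transpose]

lemma norm_rotMatrix_mulVec (θ : ℝ) (v : Plane) : ‖matVec (rotMatrix θ) v‖ = ‖v‖ := by
  refine (sq_eq_sq₀ (norm_nonneg _) (norm_nonneg _)).1 ?_
  rw [norm_plane_sq, norm_plane_sq, rotMatrix_mulVec_zero, rotMatrix_mulVec_one]
  linear_combination (v 0 ^ 2 + v 1 ^ 2) * Real.sin_sq_add_cos_sq θ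

lemma norm_sub_rotMatrix_mulVec_sq {θ : ℝ} {u v : Plane} (hu : ‖u‖ = 1) (hv : ‖v‖ = 1) :
    ‖v - matVec (rotMatrix θ) u‖ ^ 2 = 2 * (1 - cosErr θ u v) := by
  have h1 : u 0 ^ 2 + u 1 ^ 2 = 1 := by rw [← norm_plane_sq, hu, one_pow]
  have h2 : v 0 ^ 2 + v 1 ^ 2 = 1 := by rw [← norm_plane_sq, hv, one_pow]
  rw [norm_plane_sq, PiLp.sub_apply, PiLp.sub_apply, rotMatrix_mulVec_zero, rotMatrix_mulVec_one,
    cosErr]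
  linear_combination (u 0 ^ 2 + u 1 ^ 2) * Real.sin_sq_add_cos_sq θ + h1 + h2

/-! ### The Lyapunov function against the distance to the target set -/

/-- The Lyapunov function on configurations. -/
noncomputable def configLyapunov (d₁ d₂ θ l₁ l₂ : ℝ) (p : Config) : ℝ :=
  lyapunov l₁ l₂ (‖relPos₁ p‖ - d₁) (‖relPos₂ p‖ - d₂)
    (sinErr θ (truncUnit (d₁ / 2) (relPos₁ p)) (truncUnit (d₂ / 2) (relPos₂ p)))
    (cosErr θ (truncUnit (d₁ / 2) (relPos₁ p)) (truncUnit (d₂ / 2) (relPos₂ p)))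

lemma norm_relPos₁_sub_le (p q : Config) : ‖relPos₁ p - relPos₁ q‖ ≤ 2 * dist p q := by
  have e : relPos₁ p - relPos₁ q = (p 0 - q 0) - (p 1 - q 1) := by
    simp only [relPos₁]; abel
  rw [e]
  refine (norm_sub_le _ _).trans ?_
  rw [← dist_eq_norm, ← dist_eq_norm]
  linarith [dist_le_pi_dist p q 0, dist_le_pi_dist p q 1]

lemma norm_relPos₂_sub_le (p q : Config) : ‖relPos₂ p - relPos₂ q‖ ≤ 2 * dist p q := by
  have e : relPos₂ p - relPos₂ q = (p 1 - q 1) - (p 2 - q 2) := by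
    simp only [relPos₂]; abel
  rw [e]
  refine (norm_sub_le _ _).trans ?_
  rw [← dist_eq_norm, ← dist_eq_norm]
  linarith [dist_le_pi_dist p q 1, dist_le_pi_dist p q 2]

lemma abs_apply_le_norm (z : Plane) (i : Fin 2) : |z i| ≤ ‖z‖ := by
  simpa using PiLp.norm_apply_le z i

lemma abs_mul_sub_mul_le {a b a' b' x y : ℝ} (ha : |a - a'| ≤ x) (hb : |b - b'| ≤ y)
    (hb1 : |b| ≤ 1) (ha1 : |a'| ≤ 1) : |a * b - a' * b'| ≤ x + y := by
  have : a * b - a' * b' = (a - a') * b + a' * (b - b') := by ring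
  rw [this]
  refine (abs_add_le _ _).trans ((add_le_add (abs_mul_le_mul ha hb1)
    (abs_mul_le_mul ha1 hb)).trans_eq (by ring))

lemma abs_err_sub_le (θ : ℝ) {u v u' v' : Plane} (hv : ‖v‖ ≤ 1) (hu' : ‖u'‖ ≤ 1) :
    |sinErr θ u v - sinErr θ u' v'| ≤ 4 * (‖u - u'‖ + ‖v - v'‖) ∧
      |cosErr θ u v - cosErr θ u' v'| ≤ 4 * (‖u - u'‖ + ‖v - v'‖) := by
  have hm : ∀ i j : Fin 2, |u i * v j - u' i * v' j| ≤ ‖u - u'‖ + ‖v - v'‖ := fun i j =>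
    abs_mul_sub_mul_le (abs_apply_le_norm (u - u') i) (abs_apply_le_norm (v - v') j)
      ((abs_apply_le_norm v j).trans hv) ((abs_apply_le_norm u' i).trans hu')
  have hp : |(u 0 * v 0 - u' 0 * v' 0) + (u 1 * v 1 - u' 1 * v' 1)| ≤
      2 * (‖u - u'‖ + ‖v - v'‖) :=
    (abs_add_le _ _).trans (by linarith [hm 0 0, hm 1 1])
  have hq : |(u 0 * v 1 - u' 0 * v' 1) - (u 1 * v 0 - u' 1 * v' 0)| ≤
      2 * (‖u - u'‖ + ‖v - v'‖) :=
    (abs_sub _ _).trans (by linarith [hm 0 1, hm 1 0])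
  constructor
  · have e : sinErr θ u v - sinErr θ u' v' =
        ((u 0 * v 1 - u' 0 * v' 1) - (u 1 * v 0 - u' 1 * v' 0)) * Real.cos θ -
        ((u 0 * v 0 - u' 0 * v' 0) + (u 1 * v 1 - u' 1 * v' 1)) * Real.sin θ := by
      simp only [sinErr]; ring
    rw [e]
    refine (abs_sub _ _).trans ((add_le_add (abs_mul_le_mul hq (Real.abs_cos_le_one θ))
      (abs_mul_le_mul hp (Real.abs_sin_le_one θ))).trans_eq (by ring))
  · have e : cosErr θ u v - cosErr θ u' v' =
        ((u 0 * v 0 - u' 0 * v' 0) + (u 1 * v 1 - u' 1 * v' 1)) * Real.cos θ +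
        ((u 0 * v 1 - u' 0 * v' 1) - (u 1 * v 0 - u' 1 * v' 0)) * Real.sin θ := by
      simp only [cosErr]; ring
    rw [e]
    refine (abs_add_le _ _).trans ((add_le_add (abs_mul_le_mul hp (Real.abs_cos_le_one θ))
      (abs_mul_le_mul hq (Real.abs_sin_le_one θ))).trans_eq (by ring))

lemma err_of_mem_targetSet {d₁ d₂ θ : ℝ} (hd₁ : 0 < d₁) {q : Config} (hq : q ∈ targetSet d₁ d₂ θ) :
    sinErr θ (unitVec (relPos₁ q)) (unitVec (relPos₂ q)) = 0 ∧
      cosErr θ (unitVec (relPos₁ q)) (unitVec (relPos₂ q)) = 1 := by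
  have hu : ‖unitVec (relPos₁ q)‖ = 1 := norm_unitVec (norm_pos_iff.1 (by rw [hq.2.1]; exact hd₁))
  have h1 := norm_plane_sq (unitVec (relPos₁ q))
  rw [hu] at h1
  rw [← sub_eq_zero.1 hq.1, sinErr, cosErr, rotMatrix_mulVec_zero, rotMatrix_mulVec_one]
  constructor
  · ring
  · linear_combination ((unitVec (relPos₁ q)) 0 ^ 2 + (unitVec (relPos₁ q)) 1 ^ 2) *
      Real.sin_sq_add_cos_sq θ - h1

/-- The Lyapunov function is at most quadratic in the distance to the target set. -/
lemma exists_configLyapunov_le {d₁ d₂ : ℝ} (hd₁ : 0 < d₁) (hd₂ : 0 < d₂) (θ l₁ l₂ : ℝ) :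
    ∃ K > (0 : ℝ), ∀ p q, q ∈ targetSet d₁ d₂ θ →
      configLyapunov d₁ d₂ θ l₁ l₂ p ≤ (K * dist p q) ^ 2 := by
  set B := 4 * (2 / (d₁ / 2) * 2 + 2 / (d₂ / 2) * 2) with hB
  have hB0 : 0 < B := by positivity
  refine ⟨2 + 2 + (B + |l₁| * 2 + |l₂| * 2) + B, by positivity, fun p q hq => ?_⟩
  set D := dist p q with hD
  have hD0 : 0 ≤ D := dist_nonneg
  have h1 := norm_relPos₁_sub_le p q
  have h2 := norm_relPos₂_sub_le p q
  have he1 : |‖relPos₁ p‖ - d₁| ≤ 2 * D := by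
    rw [← hq.2.1]; exact (abs_norm_sub_norm_le _ _).trans h1
  have he2 : |‖relPos₂ p‖ - d₂| ≤ 2 * D := by
    rw [← hq.2.2]; exact (abs_norm_sub_norm_le _ _).trans h2
  obtain ⟨hs, hc⟩ := err_of_mem_targetSet hd₁ hq
  have hu : truncUnit (d₁ / 2) (relPos₁ q) = unitVec (relPos₁ q) :=
    truncUnit_eq_unitVec (by rw [hq.2.1]; linarith)
  have hv : truncUnit (d₂ / 2) (relPos₂ q) = unitVec (relPos₂ q) :=
    truncUnit_eq_unitVec (by rw [hq.2.2]; linarith)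
  obtain ⟨k1, k2⟩ := abs_err_sub_le θ (u := truncUnit (d₁ / 2) (relPos₁ p))
    (v := truncUnit (d₂ / 2) (relPos₂ p)) (u' := truncUnit (d₁ / 2) (relPos₁ q))
    (v' := truncUnit (d₂ / 2) (relPos₂ q)) (norm_truncUnit_le_one (by positivity) _)
    (norm_truncUnit_le_one (by positivity) _)
  have hBD : 4 * (‖truncUnit (d₁ / 2) (relPos₁ p) - truncUnit (d₁ / 2) (relPos₁ q)‖ +
      ‖truncUnit (d₂ / 2) (relPos₂ p) - truncUnit (d₂ / 2) (relPos₂ q)‖) ≤ B * D := by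
    have j1 := (norm_truncUnit_sub_le (by positivity : 0 < d₁ / 2) (relPos₁ p) (relPos₁ q)).trans
      (mul_le_mul_of_nonneg_left h1 (by positivity))
    have j2 := (norm_truncUnit_sub_le (by positivity : 0 < d₂ / 2) (relPos₂ p) (relPos₂ q)).trans
      (mul_le_mul_of_nonneg_left h2 (by positivity))
    refine (mul_le_mul_of_nonneg_left (add_le_add j1 j2) (by norm_num)).trans_eq ?_
    rw [hB]; ring
  rw [hu, hv] at k1 k2 hBD
  rw [hs, sub_zero] at k1
  rw [hc, abs_sub_comm] at k2
  replace k1 := k1.trans hBD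
  replace k2 := k2.trans hBD
  rw [configLyapunov, lyapunov]
  set e₁ := ‖relPos₁ p‖ - d₁
  set e₂ := ‖relPos₂ p‖ - d₂
  set σ := sinErr θ (truncUnit (d₁ / 2) (relPos₁ p)) (truncUnit (d₂ / 2) (relPos₂ p))
  set κ := cosErr θ (truncUnit (d₁ / 2) (relPos₁ p)) (truncUnit (d₂ / 2) (relPos₂ p))
  have hψ : |σ + l₁ * e₁ + l₂ * e₂| ≤ B * D + |l₁| * (2 * D) + |l₂| * (2 * D) :=
    (abs_add_three _ _ _).trans (add_le_add_three k1 (abs_mul_le_mul le_rfl he1)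
      (abs_mul_le_mul le_rfl he2))
  have sqle : ∀ {a b : ℝ}, |a| ≤ b → a ^ 2 ≤ b ^ 2 := fun {a b} h => by
    rw [← sq_abs a]; exact pow_le_pow_left₀ (abs_nonneg _) h 2
  have hl : 0 ≤ |l₁| := abs_nonneg _
  have hl' : 0 ≤ |l₂| := abs_nonneg _
  -- V is a sum of four squares of functions that vanish on the target set and are bounded by
  -- multiples of D; a sum of squares is at most the square of the sum.
  refine (add_le_add (add_le_add (add_le_add (sqle he1) (sqle he2)) (sqle hψ)) (sqle k2)).trans ?_
  generalize |l₁| = x at *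
  generalize |l₂| = y at *
  have : (2 * D) ^ 2 + (2 * D) ^ 2 + (B * D + x * (2 * D) + y * (2 * D)) ^ 2 + (B * D) ^ 2 =
    (2 ^ 2 + 2 ^ 2 + (B + x * 2 + y * 2) ^ 2 + B ^ 2) * D ^ 2 := by ring
  rw [this, mul_pow _ D]
  refine mul_le_mul_of_nonneg_right ?_ (sq_nonneg D)
  have hz : 0 ≤ B + x * 2 + y * 2 := by positivity
  generalize B + x * 2 + y * 2 = z at *
  have z1 : 0 ≤ z * B := by positivity
  linarith

/-- The configuration in the target set with the same middle agent and direction of `z₁`. -/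
noncomputable def nearestTarget (d₁ d₂ θ : ℝ) (p : Config) : Config :=
  ![p 1 + d₁ • unitVec (relPos₁ p), p 1, p 1 - d₂ • matVec (rotMatrix θ) (unitVec (relPos₁ p))]

lemma unitVec_smul {d : ℝ} (hd : 0 < d) {u : Plane} (hu : ‖u‖ = 1) : unitVec (d • u) = u := by
  rw [unitVec, norm_smul, hu, Real.norm_of_nonneg hd.le, mul_one, smul_smul,
    inv_mul_cancel₀ hd.ne', one_smul]

lemma nearestTarget_mem {d₁ d₂ : ℝ} (hd₁ : 0 < d₁) (hd₂ : 0 < d₂) (θ : ℝ) {p : Config}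
    (hp : relPos₁ p ≠ 0) : nearestTarget d₁ d₂ θ p ∈ targetSet d₁ d₂ θ := by
  have hu := norm_unitVec hp
  have h1 : relPos₁ (nearestTarget d₁ d₂ θ p) = d₁ • unitVec (relPos₁ p) := by
    rw [relPos₁]; simp [nearestTarget]
  have h2 : relPos₂ (nearestTarget d₁ d₂ θ p) =
      d₂ • matVec (rotMatrix θ) (unitVec (relPos₁ p)) := by
    rw [relPos₂]; simp [nearestTarget]
  have hw : ‖matVec (rotMatrix θ) (unitVec (relPos₁ p))‖ = 1 := by
    rw [norm_rotMatrix_mulVec, hu]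
  refine ⟨?_, ?_, ?_⟩
  · rw [h1, h2, unitVec_smul hd₁ hu, unitVec_smul hd₂ hw, sub_self]
  · rw [h1, norm_smul, hu, Real.norm_of_nonneg hd₁.le, mul_one]
  · rw [h2, norm_smul, hw, Real.norm_of_nonneg hd₂.le, mul_one]

lemma sub_smul_unitVec {z : Plane} (hz : z ≠ 0) (d : ℝ) :
    z - d • unitVec z = (‖z‖ - d) • unitVec z := by
  rw [sub_smul, unitVec, smul_smul ‖z‖, mul_inv_cancel₀ (norm_ne_zero_iff.2 hz), one_smul]

/-- Any point of the target set bounds the distance, so `nearestTarget` need not minimise it. The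
condition on the cosine is needed because σ also vanishes at the antipodal angle; it gives ‖ẑ₂ -
W(θ)ẑ₁‖² = 2(1 - κ) ≤ 2σ². -/
lemma infDist_targetSet_le {d₁ d₂ : ℝ} (hd₁ : 0 < d₁) (hd₂ : 0 < d₂) (θ : ℝ) {p : Config}
    (hp₁ : relPos₁ p ≠ 0) (hp₂ : relPos₂ p ≠ 0)
    (hκ : 0 ≤ cosErr θ (unitVec (relPos₁ p)) (unitVec (relPos₂ p))) :
    Metric.infDist p (targetSet d₁ d₂ θ) ≤ |‖relPos₁ p‖ - d₁| + |‖relPos₂ p‖ - d₂| +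
      2 * d₂ * |sinErr θ (unitVec (relPos₁ p)) (unitVec (relPos₂ p))| := by
  refine (Metric.infDist_le_dist_of_mem (nearestTarget_mem hd₁ hd₂ θ hp₁)).trans ?_
  have hu := norm_unitVec hp₁
  have hv := norm_unitVec hp₂
  have hsc := sinErr_sq_add_cosErr_sq θ (unitVec (relPos₁ p)) (unitVec (relPos₂ p))
  have hw := norm_sub_rotMatrix_mulVec_sq (θ := θ) hu hv
  have e0 : p 0 - nearestTarget d₁ d₂ θ p 0 = (‖relPos₁ p‖ - d₁) • unitVec (relPos₁ p) := by
    rw [← sub_smul_unitVec hp₁]; simp [nearestTarget, relPos₁]; abel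
  have e1 : p 1 - nearestTarget d₁ d₂ θ p 1 = 0 := by simp [nearestTarget]
  have e2 : p 2 - nearestTarget d₁ d₂ θ p 2 = -((‖relPos₂ p‖ - d₂) • unitVec (relPos₂ p) +
      d₂ • (unitVec (relPos₂ p) - matVec (rotMatrix θ) (unitVec (relPos₁ p)))) := by
    rw [← sub_smul_unitVec hp₂, smul_sub]; simp [nearestTarget, relPos₂]; abel
  rw [hu, hv] at hsc
  set σ := sinErr θ (unitVec (relPos₁ p)) (unitVec (relPos₂ p))
  set κ := cosErr θ (unitVec (relPos₁ p)) (unitVec (relPos₂ p))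
  have hκ1 : κ ≤ 1 := (abs_le.1 (abs_le_of_sq_le_sq (by linarith [sq_nonneg σ]) zero_le_one)).2
  have hn : ‖unitVec (relPos₂ p) - matVec (rotMatrix θ) (unitVec (relPos₁ p))‖ ≤ 2 * |σ| := by
    refine abs_le_of_sq_le_sq' ?_ (by positivity) |>.2
    rw [hw, mul_pow, sq_abs]
    nlinarith
  have n1 : 0 ≤ |‖relPos₁ p‖ - d₁| := abs_nonneg _
  have n2 : 0 ≤ |‖relPos₂ p‖ - d₂| := abs_nonneg _
  have n3 : 0 ≤ 2 * d₂ * |σ| := by positivity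
  refine (dist_pi_le_iff (by positivity)).2 fun i => ?_
  rw [dist_eq_norm]
  fin_cases i
  · change ‖p 0 - nearestTarget d₁ d₂ θ p 0‖ ≤ _
    rw [e0, norm_smul, hu, Real.norm_eq_abs]
    linarith
  · change ‖p 1 - nearestTarget d₁ d₂ θ p 1‖ ≤ _
    rw [e1, norm_zero]
    linarith
  · change ‖p 2 - nearestTarget d₁ d₂ θ p 2‖ ≤ _
    rw [e2, norm_neg]
    refine (norm_add_le _ _).trans ?_
    rw [norm_smul, norm_smul, hv, Real.norm_eq_abs, Real.norm_of_nonneg hd₂.le]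
    linarith [mul_le_mul_of_nonneg_left hn hd₂.le]

/-! ### A bounded Lipschitz replacement for the closed-loop field -/

/-- Bounded Lipschitz maps. -/
def IsBoundedLipschitz {X E : Type*} [PseudoEMetricSpace X] [NormedAddCommGroup E]
    (f : X → E) : Prop :=
  ∃ K L : NNReal, LipschitzWith K f ∧ ∀ x, ‖f x‖ ≤ L

namespace IsBoundedLipschitz

variable {X E F : Type*} [PseudoEMetricSpace X] [NormedAddCommGroup E] [NormedAddCommGroup F]
  {f g : X → E}

lemma add (hf : IsBoundedLipschitz f) (hg : IsBoundedLipschitz g) :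
    IsBoundedLipschitz fun x => f x + g x := by
  obtain ⟨K, L, hK, hL⟩ := hf
  obtain ⟨K', L', hK', hL'⟩ := hg
  exact ⟨K + K', L + L', hK.add hK', fun x => (norm_add_le _ _).trans (add_le_add (hL x) (hL' x))⟩

lemma pi {ι : Type*} [Fintype ι] {X : Type*} [PseudoMetricSpace X] {f : ι → X → E}
    (hf : ∀ i, IsBoundedLipschitz (f i)) : IsBoundedLipschitz fun x i => f i x := by
  choose K L hK hL using hf
  refine ⟨∑ i, K i, ∑ i, L i, LipschitzWith.of_dist_le_mul fun x y => ?_, fun x => ?_⟩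
  · refine (dist_pi_le_iff (by positivity)).2 fun i => ((hK i).dist_le_mul x y).trans ?_
    refine mul_le_mul_of_nonneg_right ?_ dist_nonneg
    exact_mod_cast Finset.single_le_sum (f := K) (fun j _ => zero_le) (Finset.mem_univ i)
  · refine (pi_norm_le_iff_of_nonneg (by positivity)).2 fun i => (hL i x).trans ?_
    exact_mod_cast Finset.single_le_sum (f := L) (fun j _ => zero_le) (Finset.mem_univ i)

variable [NormedSpace ℝ E] [NormedSpace ℝ F]

lemma clm_comp (A : E →L[ℝ] F) (hf : IsBoundedLipschitz f) :
    IsBoundedLipschitz fun x => A (f x) := by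
  obtain ⟨K, L, hK, hL⟩ := hf
  exact ⟨‖A‖₊ * K, ‖A‖₊ * L, A.lipschitz.comp hK, fun x => (A.le_opNorm _).trans
    (mul_le_mul_of_nonneg_left (hL x) (norm_nonneg _))⟩

lemma const_smul (c : ℝ) (hf : IsBoundedLipschitz f) : IsBoundedLipschitz fun x => c • f x :=
  hf.clm_comp (c • ContinuousLinearMap.id ℝ E)

lemma neg (hf : IsBoundedLipschitz f) : IsBoundedLipschitz fun x => -f x := by
  simpa using hf.const_smul (-1)

lemma sub (hf : IsBoundedLipschitz f) (hg : IsBoundedLipschitz g) :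
    IsBoundedLipschitz fun x => f x - g x := by
  simpa [sub_eq_add_neg] using hf.add hg.neg

end IsBoundedLipschitz

lemma lipschitzWith_truncUnit {δ : ℝ} (hδ : 0 < δ) :
    LipschitzWith (2 / δ).toNNReal (truncUnit δ) :=
  LipschitzWith.of_dist_le_mul fun z w => by
    rw [Real.coe_toNNReal _ (by positivity), dist_eq_norm, dist_eq_norm]
    exact norm_truncUnit_sub_le hδ z w

lemma isBoundedLipschitz_truncUnit_comp {X : Type*} [PseudoEMetricSpace X] {δ : ℝ} (hδ : 0 < δ)
    {K : NNReal} {f : X → Plane} (hf : LipschitzWith K f) :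
    IsBoundedLipschitz fun x => truncUnit δ (f x) :=
  ⟨_, 1, (lipschitzWith_truncUnit hδ).comp hf, fun x => by
    simpa using norm_truncUnit_le_one hδ (f x)⟩

lemma isBoundedLipschitz_matVec_comp {X : Type*} [PseudoEMetricSpace X]
    (A : Matrix (Fin 2) (Fin 2) ℝ) {f : X → Plane} (hf : IsBoundedLipschitz f) :
    IsBoundedLipschitz fun x => matVec A (f x) :=
  hf.clm_comp (Matrix.toEuclideanCLM (𝕜 := ℝ) A)

lemma lipschitzWith_relPos₁ : LipschitzWith 2 relPos₁ :=
  LipschitzWith.of_dist_le_mul fun p q => by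
    rw [dist_eq_norm]; exact norm_relPos₁_sub_le p q

lemma lipschitzWith_relPos₂ : LipschitzWith 2 relPos₂ :=
  LipschitzWith.of_dist_le_mul fun p q => by
    rw [dist_eq_norm]; exact norm_relPos₂_sub_le p q

/-- The vector `(‖z‖ - d) z / ‖z‖`, cut off for small and for large `z`. -/
noncomputable def truncForce (d : ℝ) (z : Plane) : Plane :=
  (2 * d) • truncUnit (2 * d) z - d • truncUnit (d / 2) z

/-- A bounded Lipschitz vector field that agrees with the closed-loop field where the distances are
close to the prescribed ones. -/
noncomputable def truncField (d₁ d₂ θ c : ℝ) (p : Config) : Config :=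
  ![-truncForce d₁ (relPos₁ p),
    truncForce d₁ (relPos₁ p) - truncForce d₂ (relPos₂ p)
      + c • (matVec (rotMatrix (θ / 2)) (truncUnit (d₁ / 2) (relPos₁ p)) -
        matVec (rotMatrix (θ / 2)).transpose (truncUnit (d₂ / 2) (relPos₂ p))),
    truncForce d₂ (relPos₂ p)]

lemma isBoundedLipschitz_truncField {d₁ d₂ : ℝ} (hd₁ : 0 < d₁) (hd₂ : 0 < d₂) (θ c : ℝ) :
    IsBoundedLipschitz (truncField d₁ d₂ θ c) := by
  have u₁ := isBoundedLipschitz_truncUnit_comp (half_pos hd₁) lipschitzWith_relPos₁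
  have u₂ := isBoundedLipschitz_truncUnit_comp (half_pos hd₂) lipschitzWith_relPos₂
  have b₁ : IsBoundedLipschitz fun p => truncForce d₁ (relPos₁ p) :=
    ((isBoundedLipschitz_truncUnit_comp (mul_pos two_pos hd₁) lipschitzWith_relPos₁).const_smul
      _).sub (u₁.const_smul d₁)
  have b₂ : IsBoundedLipschitz fun p => truncForce d₂ (relPos₂ p) :=
    ((isBoundedLipschitz_truncUnit_comp (mul_pos two_pos hd₂) lipschitzWith_relPos₂).const_smul
      _).sub (u₂.const_smul d₂)
  refine IsBoundedLipschitz.pi (f := fun i p => truncField d₁ d₂ θ c p i) fun i => ?_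
  fin_cases i
  · exact b₁.neg
  · exact (b₁.sub b₂).add (((isBoundedLipschitz_matVec_comp _ u₁).sub
      (isBoundedLipschitz_matVec_comp _ u₂)).const_smul c)
  · exact b₂

/-- The first summand of `truncForce` is the radial projection of z onto the ball of radius 2d,
hence z itself in this range. -/
lemma truncForce_eq {d : ℝ} (hd : 0 < d) {z : Plane} (h₁ : d / 2 ≤ ‖z‖) (h₂ : ‖z‖ ≤ 2 * d) :
    truncForce d z = (‖z‖ - d) • unitVec z := by
  have hz : z ≠ 0 := norm_pos_iff.1 (by linarith)
  rw [truncForce, truncUnit_eq_unitVec h₁, truncUnit, max_eq_left h₂, smul_smul,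
    mul_inv_cancel₀ (by positivity), one_smul, sub_smul_unitVec hz]

lemma truncField_eq {d₁ d₂ : ℝ} (hd₁ : 0 < d₁) (hd₂ : 0 < d₂) (θ c : ℝ) {p : Config}
    (h₁ : |‖relPos₁ p‖ - d₁| < d₁ / 2) (h₂ : |‖relPos₂ p‖ - d₂| < d₂ / 2) :
    truncField d₁ d₂ θ c p = formationField d₁ d₂ θ c p := by
  obtain ⟨a₁, b₁⟩ := abs_lt.1 h₁
  obtain ⟨a₂, b₂⟩ := abs_lt.1 h₂
  rw [truncField, truncForce_eq hd₁ (by linarith) (by linarith),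
    truncForce_eq hd₂ (by linarith) (by linarith), truncUnit_eq_unitVec (by linarith),
    truncUnit_eq_unitVec (by linarith)]
  rfl

/-! ### The Lyapunov function along trajectories -/

lemma continuous_configLyapunov {d₁ d₂ : ℝ} (hd₁ : 0 < d₁) (hd₂ : 0 < d₂) (θ l₁ l₂ : ℝ) :
    Continuous (configLyapunov d₁ d₂ θ l₁ l₂) := by
  have z₁ := lipschitzWith_relPos₁.continuous
  have z₂ := lipschitzWith_relPos₂.continuous
  have u₁ := (lipschitzWith_truncUnit (half_pos hd₁)).continuous.comp z₁
  have u₂ := (lipschitzWith_truncUnit (half_pos hd₂)).continuous.comp z₂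
  have : ∀ f g : Config → Plane, Continuous f → Continuous g → Continuous fun p =>
      lyapunov l₁ l₂ (‖relPos₁ p‖ - d₁) (‖relPos₂ p‖ - d₂) (sinErr θ (f p) (g p))
        (cosErr θ (f p) (g p)) := fun f g hf hg => by
    unfold lyapunov sinErr cosErr
    fun_prop
  exact this _ _ u₁ u₂

lemma hasDerivWithinAt_apply {z : ℝ → Plane} {g : Plane} {J : Set ℝ} {t : ℝ}
    (h : HasDerivWithinAt z g J t) (i : Fin 2) : HasDerivWithinAt (fun τ => z τ i) (g i) J t :=
  (EuclideanSpace.proj (𝕜 := ℝ) i).hasFDerivAt.comp_hasDerivWithinAt t h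

/-- The derivatives of the norm and the direction of a curve in the plane. -/
lemma hasDerivWithinAt_norm_and_truncUnit {z : ℝ → Plane} {g : Plane} {J : Set ℝ} {t δ : ℝ}
    (h : HasDerivWithinAt z g J t) (ht : t ∈ J) (hδ : 0 < δ) (hz : δ < ‖z t‖) :
    HasDerivWithinAt (fun τ => ‖z τ‖) (unitVec (z t) 0 * g 0 + unitVec (z t) 1 * g 1) J t ∧
    HasDerivWithinAt (fun τ => truncUnit δ (z τ) 0) (-(unitVec (z t) 1 *
      ((unitVec (z t) 0 * g 1 - unitVec (z t) 1 * g 0) / ‖z t‖))) J t ∧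
    HasDerivWithinAt (fun τ => truncUnit δ (z τ) 1) (unitVec (z t) 0 *
      ((unitVec (z t) 0 * g 1 - unitVec (z t) 1 * g 0) / ‖z t‖)) J t := by
  have h0 := hasDerivWithinAt_apply h 0
  have h1 := hasDerivWithinAt_apply h 1
  have hn0 : 0 < ‖z t‖ := hδ.trans hz
  have hsq : ‖z t‖ ^ 2 = z t 0 ^ 2 + z t 1 ^ 2 := norm_plane_sq _
  have hsqrt : ∀ y : Plane, √(y 0 ^ 2 + y 1 ^ 2) = ‖y‖ := fun y => by
    rw [← norm_plane_sq, Real.sqrt_sq (norm_nonneg _)]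
  have hn : HasDerivWithinAt (fun τ => ‖z τ‖)
      (unitVec (z t) 0 * g 0 + unitVec (z t) 1 * g 1) J t := by
    have := ((h0.fun_pow 2).fun_add (h1.fun_pow 2)).sqrt (by rw [← hsq]; positivity)
    simp only [hsqrt] at this
    convert this using 1
    simp [unitVec]
    field_simp
  have hev : ∀ i, (fun τ => truncUnit δ (z τ) i) =ᶠ[nhdsWithin t J]
      fun τ => ‖z τ‖⁻¹ * z τ i := fun i => by
    have : ∀ᶠ τ in nhdsWithin t J, δ < ‖z τ‖ :=
      h.continuousWithinAt.norm.eventually (lt_mem_nhds hz)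
    filter_upwards [this] with τ hτ
    rw [truncUnit_eq_unitVec hτ.le]
    simp [unitVec]
  have hd : ∀ i, HasDerivWithinAt (fun τ => truncUnit δ (z τ) i)
      (-(unitVec (z t) 0 * g 0 + unitVec (z t) 1 * g 1) / ‖z t‖ ^ 2 * z t i +
        ‖z t‖⁻¹ * g i) J t := fun i =>
    ((hn.fun_inv hn0.ne').fun_mul (hasDerivWithinAt_apply h i)).congr_of_eventuallyEq (hev i)
      ((hev i).self_of_nhdsWithin ht)
  refine ⟨hn, ?_, ?_⟩
  · convert hd 0 using 1
    simp only [unitVec, PiLp.smul_apply, smul_eq_mul]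
    field_simp
    rw [hsq]; ring
  · convert hd 1 using 1
    simp only [unitVec, PiLp.smul_apply, smul_eq_mul]
    field_simp
    rw [hsq]; ring

/-- The derivative of the Lyapunov function along the closed-loop system. -/
lemma hasDerivWithinAt_configLyapunov {d₁ d₂ θ c : ℝ} (hd₁ : 0 < d₁) (hd₂ : 0 < d₂) (l₁ l₂ : ℝ)
    {x : ℝ → Config} {J : Set ℝ} {t : ℝ} (ht : t ∈ J)
    (hx : HasDerivWithinAt x (formationField d₁ d₂ θ c (x t)) J t)
    (h₁ : d₁ / 2 < ‖relPos₁ (x t)‖) (h₂ : d₂ / 2 < ‖relPos₂ (x t)‖) :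
    HasDerivWithinAt (fun τ => configLyapunov d₁ d₂ θ l₁ l₂ (x τ))
      (lyapunovDeriv d₁ d₂ (Real.cos (θ / 2)) (Real.sin (θ / 2)) c l₁ l₂
        (‖relPos₁ (x t)‖ - d₁) (‖relPos₂ (x t)‖ - d₂)
        (sinErr θ (unitVec (relPos₁ (x t))) (unitVec (relPos₂ (x t))))
        (cosErr θ (unitVec (relPos₁ (x t))) (unitVec (relPos₂ (x t))))) J t := by
  have hxi := hasDerivWithinAt_pi.1 hx
  obtain ⟨n₁, a₁, b₁⟩ := hasDerivWithinAt_norm_and_truncUnit (z := fun τ => relPos₁ (x τ))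
    ((hxi 0).fun_sub (hxi 1)) ht (half_pos hd₁) h₁
  obtain ⟨n₂, a₂, b₂⟩ := hasDerivWithinAt_norm_and_truncUnit (z := fun τ => relPos₂ (x τ))
    ((hxi 1).fun_sub (hxi 2)) ht (half_pos hd₂) h₂
  have hu₁ := truncUnit_eq_unitVec h₁.le
  have hu₂ := truncUnit_eq_unitVec h₂.le
  have nu₁ := norm_plane_sq (unitVec (relPos₁ (x t)))
  have nu₂ := norm_plane_sq (unitVec (relPos₂ (x t)))
  rw [norm_unitVec (norm_pos_iff.1 ((half_pos hd₁).trans h₁)), one_pow] at nu₁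
  rw [norm_unitVec (norm_pos_iff.1 ((half_pos hd₂).trans h₂)), one_pow] at nu₂
  have f0 : formationField d₁ d₂ θ c (x t) 0 =
    -((‖relPos₁ (x t)‖ - d₁) • unitVec (relPos₁ (x t))) := rfl
  have f1 : formationField d₁ d₂ θ c (x t) 1 =
    (‖relPos₁ (x t)‖ - d₁) • unitVec (relPos₁ (x t)) -
      (‖relPos₂ (x t)‖ - d₂) • unitVec (relPos₂ (x t)) +
      c • (matVec (rotMatrix (θ / 2)) (unitVec (relPos₁ (x t))) -
        matVec (rotMatrix (θ / 2)).transpose (unitVec (relPos₂ (x t)))) := rfl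
  have f2 : formationField d₁ d₂ θ c (x t) 2 =
    (‖relPos₂ (x t)‖ - d₂) • unitVec (relPos₂ (x t)) := rfl
  have hC2 : Real.cos θ = Real.cos (θ / 2) ^ 2 - Real.sin (θ / 2) ^ 2 := by
    rw [← Real.cos_two_mul']; congr 1; ring
  have hS2 : Real.sin θ = 2 * Real.sin (θ / 2) * Real.cos (θ / 2) := by
    rw [← Real.sin_two_mul]; congr 1; ring
  have hcs := Real.sin_sq_add_cos_sq (θ / 2)
  simp only [f0, f1, f2, PiLp.sub_apply, PiLp.add_apply, PiLp.neg_apply, PiLp.smul_apply,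
    smul_eq_mul, rotMatrix_mulVec_zero, rotMatrix_mulVec_one, rotMatrix_transpose_mulVec_zero,
    rotMatrix_transpose_mulVec_one] at n₁ n₂ a₁ a₂ b₁ b₂
  have hp := (a₁.fun_mul a₂).fun_add (b₁.fun_mul b₂)
  have hq := (a₁.fun_mul b₂).fun_sub (b₁.fun_mul a₂)
  have hκ := (hp.mul_const (Real.cos θ)).fun_add (hq.mul_const (Real.sin θ))
  have hσ := (hq.mul_const (Real.cos θ)).fun_sub (hp.mul_const (Real.sin θ))
  have he₁ := n₁.sub_const d₁
  have he₂ := n₂.sub_const d₂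
  have hV := (((he₁.fun_pow 2).fun_add (he₂.fun_pow 2)).fun_add
    (((hσ.fun_add (he₁.const_mul l₁)).fun_add (he₂.const_mul l₂)).fun_pow 2)).fun_add
      ((hκ.const_sub 1).fun_pow 2)
  refine HasDerivWithinAt.congr_deriv hV ?_
  clear hV hσ hκ hp hq he₁ he₂ n₁ n₂ a₁ a₂ b₁ b₂
  simp only [hu₁, hu₂]
  have hn₁ : 0 < ‖relPos₁ (x t)‖ := (half_pos hd₁).trans h₁
  have hn₂ : 0 < ‖relPos₂ (x t)‖ := (half_pos hd₂).trans h₂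
  rw [lyapunovDeriv, errDeriv₁, errDeriv₂, angleDeriv, sinErr, cosErr, add_sub_cancel,
    add_sub_cancel, hC2, hS2]
  clear f0 f1 f2 hC2 hS2 hu₁ hu₂ hxi hx
  generalize ‖relPos₁ (x t)‖ = m₁ at *
  generalize ‖relPos₂ (x t)‖ = m₂ at *
  generalize unitVec (relPos₁ (x t)) 0 = a₁ at *
  generalize unitVec (relPos₁ (x t)) 1 = b₁ at *
  generalize unitVec (relPos₂ (x t)) 0 = a₂ at *
  generalize unitVec (relPos₂ (x t)) 1 = b₂ at *
  generalize Real.cos (θ / 2) = C at *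
  generalize Real.sin (θ / 2) = s at *
  generalize he₁ : m₁ - d₁ = e₁
  generalize he₂ : m₂ - d₂ = e₂
  -- `X₁`, `X₂` are the radial components ẑₖ · żₖ, and `Y₁`, `Y₂` the cross products ẑₖ × żₖ,
  -- written through the dot and cross product of ẑ₁ and ẑ₂.
  have X₁ : a₁ * (-(e₁ * a₁) - (e₁ * a₁ - e₂ * a₂ + c * (C * a₁ - s * b₁ - (C * a₂ + s * b₂)))) +
      b₁ * (-(e₁ * b₁) - (e₁ * b₁ - e₂ * b₂ + c * (s * a₁ + C * b₁ - (-s * a₂ + C * b₂)))) =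
      -2 * e₁ + e₂ * (a₁ * a₂ + b₁ * b₂) -
        c * (C - C * (a₁ * a₂ + b₁ * b₂) - s * (a₁ * b₂ - b₁ * a₂)) := by
    linear_combination (2 * e₁ + c * C) * nu₁
  have X₂ : a₂ * (e₁ * a₁ - e₂ * a₂ + c * (C * a₁ - s * b₁ - (C * a₂ + s * b₂)) - e₂ * a₂) +
      b₂ * (e₁ * b₁ - e₂ * b₂ + c * (s * a₁ + C * b₁ - (-s * a₂ + C * b₂)) - e₂ * b₂) =
      e₁ * (a₁ * a₂ + b₁ * b₂) - 2 * e₂ -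
        c * (C - C * (a₁ * a₂ + b₁ * b₂) - s * (a₁ * b₂ - b₁ * a₂)) := by
    linear_combination (2 * e₂ + c * C) * nu₂
  have Y₁ : a₁ * (-(e₁ * b₁) - (e₁ * b₁ - e₂ * b₂ + c * (s * a₁ + C * b₁ - (-s * a₂ + C * b₂)))) -
      b₁ * (-(e₁ * a₁) - (e₁ * a₁ - e₂ * a₂ + c * (C * a₁ - s * b₁ - (C * a₂ + s * b₂)))) =
      e₂ * (a₁ * b₂ - b₁ * a₂) +
        c * (C * (a₁ * b₂ - b₁ * a₂) - s * (a₁ * a₂ + b₁ * b₂) - s) := by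
    linear_combination c * s * nu₁
  have Y₂ : a₂ * (e₁ * b₁ - e₂ * b₂ + c * (s * a₁ + C * b₁ - (-s * a₂ + C * b₂)) - e₂ * b₂) -
      b₂ * (e₁ * a₁ - e₂ * a₂ + c * (C * a₁ - s * b₁ - (C * a₂ + s * b₂)) - e₂ * a₂) =
      -(e₁ * (a₁ * b₂ - b₁ * a₂) +
        c * (C * (a₁ * b₂ - b₁ * a₂) - s * (a₁ * a₂ + b₁ * b₂) - s)) := by
    linear_combination -c * s * nu₂
  rw [X₁, X₂, Y₁, Y₂]
  clear X₁ X₂ Y₁ Y₂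
  obtain ⟨p, hp⟩ : ∃ p, p = a₁ * a₂ + b₁ * b₂ := ⟨_, rfl⟩
  obtain ⟨q, hq⟩ : ∃ q, q = a₁ * b₂ - b₁ * a₂ := ⟨_, rfl⟩
  rw [← hp, ← hq]
  obtain ⟨κ, hκ⟩ : ∃ κ, κ = p * (C ^ 2 - s ^ 2) + q * (2 * s * C) := ⟨_, rfl⟩
  obtain ⟨σ, hσ⟩ : ∃ σ, σ = q * (C ^ 2 - s ^ 2) - p * (2 * s * C) := ⟨_, rfl⟩
  rw [← hκ, ← hσ]
  -- p and q are the cosine and sine of φ + θ, so `k₁` to `k₄` are addition formulas for the angles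
  -- θ and θ/2.
  have k₁ : (C ^ 2 - s ^ 2) * κ - 2 * s * C * σ = p := by
    rw [hκ, hσ]; linear_combination p * (C ^ 2 + s ^ 2 + 1) * hcs
  have k₂ : 2 * s * C * κ + (C ^ 2 - s ^ 2) * σ = q := by
    rw [hκ, hσ]; linear_combination q * (C ^ 2 + s ^ 2 + 1) * hcs
  have k₃ : C * (1 - κ) + s * σ = C - C * p - s * q := by
    rw [hκ, hσ]; linear_combination -(C * p + s * q) * hcs
  have k₄ : C * σ - s * (1 - κ) = C * q - s * p - s := by
    rw [hκ, hσ]; linear_combination (C * q - s * p) * hcs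
  rw [k₁, k₂, k₃, k₄]
  generalize C * q - s * p - s = Q
  generalize C - C * p - s * q = R
  -- If the unit vectors turn at rates ω₁, ω₂, the angle between them turns at rate ω₂ - ω₁.
  have hω : ∀ ω₁ ω₂ : ℝ, (-(b₁ * ω₁) * b₂ + a₁ * (a₂ * ω₂) - (a₁ * ω₁ * a₂ + b₁ * -(b₂ * ω₂))) =
      p * (ω₂ - ω₁) ∧ (-(b₁ * ω₁) * a₂ + a₁ * -(b₂ * ω₂) + (a₁ * ω₁ * b₂ + b₁ * (a₂ * ω₂))) =
      -q * (ω₂ - ω₁) := fun ω₁ ω₂ => by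
    rw [hp, hq]; constructor <;> ring
  rw [(hω _ _).1, (hω _ _).2]
  have r₁ : ∀ δ : ℝ, p * δ * (C ^ 2 - s ^ 2) - -q * δ * (2 * s * C) = κ * δ := fun δ => by
    rw [hκ]; ring
  have r₂ : ∀ δ : ℝ, -q * δ * (C ^ 2 - s ^ 2) + p * δ * (2 * s * C) = -σ * δ := fun δ => by
    rw [hσ]; ring
  rw [r₁, r₂]
  push_cast
  ring

/-! ### Equilibria and the stability theorem -/

/-- The angular term vanishes because W(θ/2)ᵀ W(θ) = W(θ/2). -/
lemma formationField_eq_zero {d₁ d₂ : ℝ} (θ c : ℝ) {p : Config} (hp : p ∈ targetSet d₁ d₂ θ) :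
    formationField d₁ d₂ θ c p = 0 := by
  obtain ⟨h, h₁, h₂⟩ := hp
  have hw : matVec (rotMatrix (θ / 2)) (unitVec (relPos₁ p)) -
      matVec (rotMatrix (θ / 2)).transpose (unitVec (relPos₂ p)) = 0 := by
    rw [← sub_eq_zero.1 h]
    have hC : Real.cos θ = Real.cos (θ / 2) ^ 2 - Real.sin (θ / 2) ^ 2 := by
      rw [← Real.cos_two_mul']; congr 1; ring
    have hS : Real.sin θ = 2 * Real.sin (θ / 2) * Real.cos (θ / 2) := by
      rw [← Real.sin_two_mul]; congr 1; ring
    have hcs := Real.sin_sq_add_cos_sq (θ / 2)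
    ext i
    fin_cases i
    · change matVec _ _ 0 - matVec _ _ 0 = 0
      rw [rotMatrix_transpose_mulVec_zero, rotMatrix_mulVec_zero, rotMatrix_mulVec_zero,
        rotMatrix_mulVec_one, hC, hS]
      linear_combination (Real.sin (θ / 2) * unitVec (relPos₁ p) 1 -
        Real.cos (θ / 2) * unitVec (relPos₁ p) 0) * hcs
    · change matVec _ _ 1 - matVec _ _ 1 = 0
      rw [rotMatrix_transpose_mulVec_one, rotMatrix_mulVec_one, rotMatrix_mulVec_zero,
        rotMatrix_mulVec_one, hC, hS]
      linear_combination (-Real.sin (θ / 2) * unitVec (relPos₁ p) 0 -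
        Real.cos (θ / 2) * unitVec (relPos₁ p) 1) * hcs
  unfold formationField
  ext i : 1
  fin_cases i <;> simp [h₁, h₂, hw]

lemma targetSet_nonempty {d₁ d₂ : ℝ} (hd₁ : 0 < d₁) (hd₂ : 0 < d₂) (θ : ℝ) :
    (targetSet d₁ d₂ θ).Nonempty := by
  refine ⟨_, nearestTarget_mem hd₁ hd₂ θ (p := ![EuclideanSpace.single 0 1, 0, 0]) ?_⟩
  rw [relPos₁]
  simp

lemma targetSet_subset_collisionFree {d₁ d₂ : ℝ} (hd₁ : 0 < d₁) (hd₂ : 0 < d₂) (θ : ℝ) :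
    targetSet d₁ d₂ θ ⊆ collisionFree := fun _ hp =>
  ⟨norm_pos_iff.1 (hp.2.1 ▸ hd₁), norm_pos_iff.1 (hp.2.2 ▸ hd₂)⟩

theorem theorem1 (d₁ d₂ : ℝ) (hd₁ : 0 < d₁) (hd₂ : 0 < d₂)
    (θ : ℝ) (hθ : θ ∈ Set.Ioo (-Real.pi) Real.pi) :
    ∃ c₀ > (0 : ℝ), ∀ c : ℝ, 0 < c → c < c₀ →
      IsLocallyExponentiallyStable (formationField d₁ d₂ θ c) collisionFree
        (targetSet d₁ d₂ θ) := by
  have hC : 0 < Real.cos (θ / 2) :=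
    Real.cos_pos_of_mem_Ioo ⟨by linarith [hθ.1], by linarith [hθ.2]⟩
  obtain ⟨l₁, l₂, c₀, hc₀, H⟩ := exists_lyapunovDeriv_le hd₁ hd₂ hC (Real.cos_sq_add_sin_sq (θ / 2))
  refine ⟨c₀, hc₀, fun c hc hcc => ⟨targetSet_nonempty hd₁ hd₂ θ,
    targetSet_subset_collisionFree hd₁ hd₂ θ, fun p hp => formationField_eq_zero θ c hp, ?_⟩⟩
  obtain ⟨ρ, hρ, a, ha, K, hK, H⟩ := H c hc hcc
  obtain ⟨M, hM, HM⟩ := exists_configLyapunov_le hd₁ hd₂ θ l₁ l₂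
  set V := configLyapunov d₁ d₂ θ l₁ l₂ with hV
  have hVc : Continuous V := continuous_configLyapunov hd₁ hd₂ θ l₁ l₂
  have hV0 : ∀ p, 0 ≤ V p := fun p => by rw [hV, configLyapunov, lyapunov]; positivity
  have hnear : ∀ p, V p < ρ → |‖relPos₁ p‖ - d₁| < d₁ / 2 ∧ |‖relPos₂ p‖ - d₂| < d₂ / 2 :=
    fun p hp => ⟨(H _ _ _ _ hp).1, (H _ _ _ _ hp).2.1⟩
  have hlow : ∀ p, V p < ρ → d₁ / 2 < ‖relPos₁ p‖ ∧ d₂ / 2 < ‖relPos₂ p‖ := fun p hp =>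
    ⟨by linarith [(abs_lt.1 (hnear p hp).1).1], by linarith [(abs_lt.1 (hnear p hp).2).1]⟩
  have hfree : ∀ p, V p < ρ → relPos₁ p ≠ 0 ∧ relPos₂ p ≠ 0 := fun p hp =>
    ⟨norm_pos_iff.1 ((half_pos hd₁).trans (hlow p hp).1),
      norm_pos_iff.1 ((half_pos hd₂).trans (hlow p hp).2)⟩
  have hVeq : ∀ p, V p < ρ → V p = lyapunov l₁ l₂ (‖relPos₁ p‖ - d₁) (‖relPos₂ p‖ - d₂)
      (sinErr θ (unitVec (relPos₁ p)) (unitVec (relPos₂ p)))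
      (cosErr θ (unitVec (relPos₁ p)) (unitVec (relPos₂ p))) := fun p hp => by
    rw [hV, configLyapunov, truncUnit_eq_unitVec (hlow p hp).1.le,
      truncUnit_eq_unitVec (hlow p hp).2.le]
  have hred := fun p (hp : V p < ρ) => (H _ _ _ _ ((hVeq p hp).symm.trans_lt hp)).2.2 (by
    rw [sinErr_sq_add_cosErr_sq, norm_unitVec (hfree p hp).1, norm_unitVec (hfree p hp).2]
    norm_num)
  -- the Lyapunov function dominates the squared distance to the target set
  have hdist : ∀ p, V p < ρ → Metric.infDist p (targetSet d₁ d₂ θ) ≤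
      (2 + 2 * d₂) * √(K * V p) := fun p hp => by
    obtain ⟨hκ, hN, -⟩ := hred p hp
    rw [← hVeq p hp] at hN
    have sq_le : ∀ y : ℝ, y ^ 2 ≤ K * V p → |y| ≤ √(K * V p) := fun y hy =>
      Real.abs_le_sqrt hy
    have q₁ := sq_nonneg (‖relPos₁ p‖ - d₁)
    have q₂ := sq_nonneg (‖relPos₂ p‖ - d₂)
    have q₃ := sq_nonneg (sinErr θ (unitVec (relPos₁ p)) (unitVec (relPos₂ p)))
    have s₁ := sq_le _ ((by linarith : (‖relPos₁ p‖ - d₁) ^ 2 ≤ _))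
    have s₂ := sq_le _ ((by linarith : (‖relPos₂ p‖ - d₂) ^ 2 ≤ _))
    have s₃ := sq_le _
      ((by linarith : sinErr θ (unitVec (relPos₁ p)) (unitVec (relPos₂ p)) ^ 2 ≤ _))
    refine (infDist_targetSet_le hd₁ hd₂ θ (hfree p hp).1 (hfree p hp).2 hκ).trans ?_
    linarith [mul_le_mul_of_nonneg_left s₃ hd₂.le]
  have hdecay : ∀ (T : ℝ) (x : ℝ → Config), ContinuousOn x (Ico 0 T) → V (x 0) < ρ →
      (∀ t ∈ Ico 0 T, V (x t) < ρ →
        HasDerivWithinAt x (formationField d₁ d₂ θ c (x t)) (Ico 0 T) t) →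
      ∀ t ∈ Ico 0 T, V (x t) ≤ V (x 0) * Real.exp (-a * t) := fun T x hx h0 hd =>
    le_mul_exp_of_deriv_le_of_lt (v := fun t => V (x t)) ha.le (hVc.comp_continuousOn hx) h0
      (hV0 _)
      (fun t ht hlt => hasDerivWithinAt_configLyapunov hd₁ hd₂ l₁ l₂ ht (hd t ht hlt)
        (hlow _ hlt).1 (hlow _ hlt).2)
      (fun t ht hlt => by
        rw [hVeq _ hlt]
        exact (hred _ hlt).2.2)
  have hstart : ∀ p, √(V p) ≤ M * Metric.infDist p (targetSet d₁ d₂ θ) := fun p => by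
    rw [← div_le_iff₀' hM, Metric.le_infDist (targetSet_nonempty hd₁ hd₂ θ)]
    intro q hq
    rw [div_le_iff₀' hM]
    exact Real.sqrt_le_iff.2 ⟨by positivity, HM p q hq⟩
  -- The distance compares with √V, hence the halved rate; the radius ensures V < ρ initially.
  refine ⟨√ρ / M, by positivity, (2 + 2 * d₂) * √K * M, by positivity, a / 2, by positivity,
    fun x₀ hx₀ => ?_⟩
  have hVx₀ : V x₀ < ρ := by
    rw [lt_div_iff₀' hM] at hx₀
    exact (Real.sqrt_lt_sqrt_iff (hV0 _)).1 ((hstart x₀).trans_lt hx₀)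
  have hle : ∀ t : ℝ, 0 ≤ t → V x₀ * Real.exp (-a * t) ≤ V x₀ := fun t ht =>
    mul_le_of_le_one_right (hV0 _) (Real.exp_le_one_iff.2 (by nlinarith))
  constructor
  -- The truncated field has a global solution; where V < ρ it equals the true field, so V decays,
  -- the solution never leaves this region, and it solves the original system.
  · obtain ⟨L, B, hL, hB⟩ := isBoundedLipschitz_truncField hd₁ hd₂ θ c
    obtain ⟨x, hx0, hx⟩ := exists_hasDerivAt_of_lipschitzWith_of_bounded hL hB x₀
    have hsmall : ∀ t : ℝ, 0 ≤ t → V (x t) < ρ := fun t ht => by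
      refine lt_of_le_of_lt ?_ hVx₀
      refine (hdecay (t + 1) x (fun τ _ => (hx τ).continuousAt.continuousWithinAt)
        (by rwa [hx0]) (fun τ _ hlt => ?_) t ⟨ht, by linarith⟩).trans ?_
      · rw [← truncField_eq hd₁ hd₂ θ c (hnear _ hlt).1 (hnear _ hlt).2]
        exact (hx τ).hasDerivWithinAt
      · rw [hx0]; exact hle t ht
    refine ⟨x, fun t ht => ⟨hfree _ (hsmall t ht), ?_⟩, hx0⟩
    rw [← truncField_eq hd₁ hd₂ θ c (hnear _ (hsmall t ht)).1 (hnear _ (hsmall t ht)).2]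
    exact (hx t).hasDerivWithinAt
  · intro T x hx hx0 t ht
    have hVt : V (x t) ≤ V x₀ * Real.exp (-a * t) := by
      rw [← hx0]
      exact hdecay T x (fun τ hτ => (hx τ hτ).2.continuousWithinAt) (by rwa [hx0])
        (fun τ hτ _ => (hx τ hτ).2) t ht
    have hexp : √(Real.exp (-a * t)) = Real.exp (-(a / 2) * t) := by
      rw [← Real.exp_half]; congr 1; ring
    calc Metric.infDist (x t) (targetSet d₁ d₂ θ)
        ≤ (2 + 2 * d₂) * √(K * V (x t)) := hdist _ ((hVt.trans (hle t ht.1)).trans_lt hVx₀)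
      _ ≤ (2 + 2 * d₂) * √(K * (V x₀ * Real.exp (-a * t))) := by gcongr
      _ = (2 + 2 * d₂) * √K * Real.exp (-(a / 2) * t) * √(V x₀) := by
        rw [Real.sqrt_mul hK.le, Real.sqrt_mul (hV0 _), hexp]; ring
      _ ≤ (2 + 2 * d₂) * √K * Real.exp (-(a / 2) * t) *
          (M * Metric.infDist x₀ (targetSet d₁ d₂ θ)) := by gcongr; exact hstart x₀
      _ = (2 + 2 * d₂) * √K * M * Real.exp (-(a / 2) * t) *
          Metric.infDist x₀ (targetSet d₁ d₂ θ) := by ring
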